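/- **Setting.** $H^2(\mathbb R)$ is the usual Sobolev space, and $H^{1,1}(\mathbb R)=\{u:\ \langle x\rangle u\in L^2(\mathbb R),\ \langle x\rangle\partial_xu\in L^2(\mathbb R)\}$ with $\langle x\rangle=(1+x^2)^{1/2}$. For $u\in H^2(\mathbb R)\cap H^{1,1}(\mathbb R)$ and $\lambda\in\mathbb C$ with $\operatorname{Im}\lambda^2\ge 0$, consider the Kaup--Newell spectral problem $$\partial_x\psi=\left[-i\lambda^2\sigma_3+\lambda Q(u)\right]\psi,\qquad \sigma_3=\begin{pmatrix}1&0\\0&-1\end{pmatrix},\qquad Q(u)=\begin{pmatrix}0&u\\-\bar u&0\end{pmatrix}.$$ Let $\varphi_-(\cdot;\lambda)$ and $\phi_+(\cdot;\lambda)$ be the unique bounded Jost functions: $\varphi_-(x;\lambda)e^{-i\lambda^2x}$ and $\phi_+(x;\lambda)e^{i\lambda^2x}$ solve the spectral problem, $\varphi_-(x;\lambda)\to e_1=(1,0)^t$ as $x\to-\infty$, and $\phi_+(x;\lambda)\to e_2=(0,1)^t$ as $x\to+\infty$. With $W(\eta,\xi)=\eta_1\xi_2-\xi_1\eta_2$,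 the scattering coefficient is the ($x$-independent) Wronskian $$a(\lambda)=W\bigl(\varphi_-(x;\lambda)e^{-i\lambda^2x},\ \phi_+(x;\lambda)e^{i\lambda^2x}\bigr),\qquad \operatorname{Im}\lambda^2\ge 0 .$$ Let $\mathbb C_I=\{\operatorname{Re}\lambda>0,\ \operatorname{Im}\lambda>0\}$, and let $Z_N$ be the set of $u\in H^2(\mathbb R)\cap H^{1,1}(\mathbb R)$ for which $a$ has exactly $N$ zeros in $\mathbb C_I$, all of them simple (i.e. $a'\ne0$ there). For $\lambda\in\mathbb C$ and $\eta=(\eta_1,\eta_2)^t$ put $$d_\lambda(\eta,\eta)=\lambda|\eta_1|^2+\bar\lambda|\eta_2|^2,\quad G_\lambda(\eta)=\frac{d_{\bar\lambda}(\eta,\eta)}{d_\lambda(\eta,\eta)},\quad S_\lambda(\eta)=2i(\lambda^2-\bar\lambda^2)\frac{\eta_1\bar\eta_2}{d_\lambda(\eta,\eta)},$$ $$\mathbf B_\lambda(\eta)u=G_\lambda(\eta)\left[-G_\lambda(\eta)u+S_\lambda(\eta)\right].$$ **Lemma.** Let $u\in Z_1$, let $\lambda_1\in\mathbb C_I$ be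 such that $a(\lambda_1)=0$, let $\eta(x)=\varphi_-(x;\lambda_1)e^{-i\lambda_1^2x}$, and let $u^{(1)}=\mathbf B_{\lambda_1}(\eta)u$. Then $u^{(1)}\in Z_0$. More precisely, $u^{(1)}\in H^2(\mathbb R)\cap H^{1,1}(\mathbb R)$, and the scattering coefficient $a^{(1)}$ of $u^{(1)}$ satisfies $$a^{(1)}(\lambda)=a(\lambda)\,\frac{\lambda_1^2}{\bar\lambda_1^2}\,\frac{\lambda^2-\bar\lambda_1^2}{\lambda^2-\lambda_1^2}$$ for all $\lambda$ with $\operatorname{Im}\lambda^2\ge0$ and $\lambda\ne\pm\lambda_1$; at $\lambda=\pm\lambda_1$ the value of $a^{(1)}$ is the limit of the right-hand side. In particular $a^{(1)}$ has no zeros in $\mathbb C_I$. -/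

import Mathlib

open scoped ComplexConjugate

noncomputable section

namespace KN

open MeasureTheory Filter Topology

/-! ### Function spaces on the real line -/

/-- `v` is the weak derivative of `u` on `ℝ`. -/
def HasWeakDeriv (u v : ℝ → ℂ) : Prop :=
  LocallyIntegrable u volume ∧ LocallyIntegrable v volume ∧
    ∀ θ : ℝ → ℝ, ContDiff ℝ (⊤ : ℕ∞) θ → HasCompactSupport θ →
      ∫ x, deriv θ x • u x = -∫ x, θ x • v x

/-- The Sobolev space `H²(ℝ)`. -/
def MemH2 (u : ℝ → ℂ) : Prop :=
  ∃ v w : ℝ → ℂ, HasWeakDeriv u v ∧ HasWeakDeriv v w ∧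
    MemLp u 2 volume ∧ MemLp v 2 volume ∧ MemLp w 2 volume

/-- The weighted space `L^{2,1}(ℝ)`, with weight `⟨x⟩ = (1 + x²)^{1/2}`. -/
def MemL21 (u : ℝ → ℂ) : Prop :=
  MemLp (fun x : ℝ => Real.sqrt (1 + x ^ 2) • u x) 2 volume

/-- The weighted Sobolev space `H^{1,1}(ℝ)`. -/
def MemH11 (u : ℝ → ℂ) : Prop :=
  ∃ v : ℝ → ℂ, HasWeakDeriv u v ∧ MemL21 u ∧ MemL21 v

/-! ### The Kaup–Newell spectral problem and its Jost functions -/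

def sigma3 : Matrix (Fin 2) (Fin 2) ℂ := !![1, 0; 0, -1]

/-- The matrix potential `Q(u)` at a point where the potential has the value `q`. -/
def potential (q : ℂ) : Matrix (Fin 2) (Fin 2) ℂ := !![0, q; -conj q, 0]

/-- The coefficient matrix `-i λ² σ₃ + λ Q(u(x))`. -/
def coeff (u : ℝ → ℂ) (l : ℂ) (x : ℝ) : Matrix (Fin 2) (Fin 2) ℂ :=
  (-Complex.I * l ^ 2) • sigma3 + l • potential (u x)

/-- `ψ` solves `∂ₓ ψ = [-i λ² σ₃ + λ Q(u)] ψ` on `ℝ`. The equation is written in integrated form: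
`ψ` is locally absolutely continuous and the equation holds almost everywhere, so the notion does
not depend on the representative of `u`. -/
def IsSolution (u : ℝ → ℂ) (l : ℂ) (ψ : ℝ → Fin 2 → ℂ) : Prop :=
  Continuous ψ ∧ ∀ x y : ℝ,
    IntervalIntegrable (fun t => (coeff u l t).mulVec (ψ t)) volume x y ∧
      ψ y - ψ x = ∫ t in x..y, (coeff u l t).mulVec (ψ t)

/-- `f` is the Jost function `φ₋(·; λ)`: it is bounded, tends to `e₁` at `-∞`, and
`f(x) e^{-iλ²x}` solves the spectral problem. -/
def IsJostMinus (u : ℝ → ℂ) (l : ℂ) (f : ℝ → Fin 2 → ℂ) : Prop :=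
  (∃ C : ℝ, ∀ x, ‖f x‖ ≤ C) ∧ Tendsto f atBot (𝓝 ![1, 0]) ∧
    IsSolution u l (fun x => Complex.exp (-Complex.I * l ^ 2 * x) • f x)

/-- `f` is the Jost function `ϕ₊(·; λ)`: it is bounded, tends to `e₂` at `+∞`, and
`f(x) e^{iλ²x}` solves the spectral problem. -/
def IsJostPlus (u : ℝ → ℂ) (l : ℂ) (f : ℝ → Fin 2 → ℂ) : Prop :=
  (∃ C : ℝ, ∀ x, ‖f x‖ ≤ C) ∧ Tendsto f atTop (𝓝 ![0, 1]) ∧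
    IsSolution u l (fun x => Complex.exp (Complex.I * l ^ 2 * x) • f x)

open Classical in
/-- The Jost function `φ₋(x; λ)`. It exists and is unique for `Im λ² ≥ 0` and `u ∈ H^{1,1}(ℝ)`. -/
def jostMinus (u : ℝ → ℂ) (l : ℂ) : ℝ → Fin 2 → ℂ :=
  if h : ∃ f, IsJostMinus u l f then h.choose else 0

open Classical in
/-- The Jost function `ϕ₊(x; λ)`. It exists and is unique for `Im λ² ≥ 0` and `u ∈ H^{1,1}(ℝ)`. -/
def jostPlus (u : ℝ → ℂ) (l : ℂ) : ℝ → Fin 2 → ℂ :=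
  if h : ∃ f, IsJostPlus u l f then h.choose else 0

/-- The Wronskian determinant `W(η, ξ) = η₁ ξ₂ - ξ₁ η₂`. -/
def wronskian (η ξ : Fin 2 → ℂ) : ℂ := η 0 * ξ 1 - ξ 0 * η 1

/-- The solution `φ₋(x; λ) e^{-iλ²x}`. -/
def minusSolution (u : ℝ → ℂ) (l : ℂ) (x : ℝ) : Fin 2 → ℂ :=
  Complex.exp (-Complex.I * l ^ 2 * x) • jostMinus u l x

/-- The solution `ϕ₊(x; λ) e^{iλ²x}`. -/
def plusSolution (u : ℝ → ℂ) (l : ℂ) (x : ℝ) : Fin 2 → ℂ :=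
  Complex.exp (Complex.I * l ^ 2 * x) • jostPlus u l x

/-- The scattering coefficient `a(λ) = W(φ₋(x; λ) e^{-iλ²x}, ϕ₊(x; λ) e^{iλ²x})` for `Im λ² ≥ 0`.
The Wronskian of two solutions does not depend on `x` because the coefficient matrix is
trace-free; it is evaluated at `x = 0`. -/
def scatA (u : ℝ → ℂ) (l : ℂ) : ℂ :=
  wronskian (minusSolution u l 0) (plusSolution u l 0)

/-- The open first quadrant. -/
def firstQuadrant : Set ℂ := {l | 0 < l.re ∧ 0 < l.im}

/-- The set `Z_N`: potentials in `H²(ℝ) ∩ H^{1,1}(ℝ)` for which `a` has exactly `N` zeros in the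
open first quadrant, all of them simple. -/
def MemZ (N : ℕ) (u : ℝ → ℂ) : Prop :=
  MemH2 u ∧ MemH11 u ∧ {l ∈ firstQuadrant | scatA u l = 0}.encard = N ∧
    ∀ l ∈ firstQuadrant, scatA u l = 0 → deriv (scatA u) l ≠ 0

/-! ### The Bäcklund transformation -/

/-- `d_λ(η, ξ) = λ η₁ ξ̄₁ + λ̄ η₂ ξ̄₂`. -/
def dForm (l : ℂ) (η ξ : Fin 2 → ℂ) : ℂ := l * η 0 * conj (ξ 0) + conj l * η 1 * conj (ξ 1)

/-- `G_λ(η) = d_{λ̄}(η, η) / d_λ(η, η)`. -/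
def opG (l : ℂ) (η : Fin 2 → ℂ) : ℂ := dForm (conj l) η η / dForm l η η

/-- `S_λ(η) = 2i (λ² - λ̄²) η₁ η̄₂ / d_λ(η, η)`. -/
def opS (l : ℂ) (η : Fin 2 → ℂ) : ℂ :=
  2 * Complex.I * (l ^ 2 - conj l ^ 2) * (η 0 * conj (η 1) / dForm l η η)

/-- `B_λ(η) u = G_λ(η) [-G_λ(η) u + S_λ(η)]`. -/
def backlund (l : ℂ) (η : ℝ → Fin 2 → ℂ) (u : ℝ → ℂ) (x : ℝ) : ℂ :=
  opG l (η x) * (-opG l (η x) * u x + opS l (η x))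

end KN

end

/-!
Write `N = |l₁|²`, `d = d_{l₁}(η, η)`, `G = G_{l₁}(η) = conj d / d` and
`b = -(l₁² - conj l₁²) η₁ conj η₂ / d`, so that `u₁ = -G² u - 2 i G b`. The Bäcklund transformation
is generated by the Darboux matrix
`T(x; l) = [[l² G - N, l b], [l conj b, N - l² conj G]]`,
which annihilates `η` at `l = l₁`. The equation of `η` turns into the closed system
`G' = u₁ conj b + b conj u`, `b' = N (u₁ + u)` with the constraints `|G| = 1` and
`N (G + conj G) - |b|² = l₁² + conj l₁²` (`isDarboux_of_isMinusPair`). It follows that `T` maps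
solutions for `u` to solutions for `u₁` and that `det T = -(l² - l₁²) (l² - conj l₁²)`.

At `-∞`, `η` is asymptotic to a multiple of `e₁`; at `+∞` it is asymptotic to a multiple of `e₂`,
because `a(l₁) = 0` makes it proportional to the other Jost solution. Hence `b → 0` at both ends,
`G → conj l₁ / l₁` at `-∞` and `G → l₁ / conj l₁` at `+∞`. Normalizing `T φ₋` and `T ϕ₊` by these
limits gives the Jost functions of `u₁` (`IsDarboux.isMinusPair`), and their Wronskian is the
asserted multiple of `a` (`IsDarboux.scatA_eq`). At `±l₁` the value of `a⁽¹⁾` is the limit of the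
formula, since `a⁽¹⁾` is continuous where `Im l² > 0` (`continuousAt_scatA`); the simple zero of
`a` at `l₁` is cancelled by the pole of the factor.

For the regularity of `u₁`, the potential is replaced by its `C¹` representative
(`exists_isRegular`), which changes neither the Jost functions nor the function classes. An energy
estimate shows that the subdominant component of a Jost function with `Im l² > 0` inherits the
weighted decay of the potential (`IsMinusPair.integrableOn_weight`), so `b ∈ L^{2,1}`
(`memL21_opB`); the closed system then expresses the derivatives of `u₁` through functions that
are known to decay (`IsDarboux.memH2_memH11`).

The Jost functions are constructed by the contraction principle (`exists_isMinusPair`); their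
uniqueness and their continuity in `l` come from Gronwall's inequality with initial time `-∞`. The
reflection `x ↦ conj (u (-x))` reduces statements about `ϕ₊` to statements about `φ₋`.
-/

namespace KN

open MeasureTheory Filter Topology

/-! ### Weak derivatives and primitives -/

/-- `F` is a primitive of the locally integrable function `f`; equivalently, `F` is locally
absolutely continuous with derivative `f` almost everywhere. -/
def IsPrimitive (F f : ℝ → ℂ) : Prop :=
  LocallyIntegrable f volume ∧ ∀ x y : ℝ, F y - F x = ∫ t in x..y, f t

lemma intervalIntegrable_of_locallyIntegrable {f : ℝ → ℂ} (hf : LocallyIntegrable f volume)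
    (x y : ℝ) : IntervalIntegrable f volume x y :=
  intervalIntegrable_iff.mpr <|
    (hf.integrableOn_isCompact isCompact_uIcc).mono_set Set.uIoc_subset_uIcc

lemma isPrimitive_intervalIntegral {f : ℝ → ℂ} (hf : LocallyIntegrable f volume) (c : ℂ) :
    IsPrimitive (fun x => c + ∫ t in (0 : ℝ)..x, f t) f := by
  refine ⟨hf, fun x y => ?_⟩
  rw [add_sub_add_left_eq_sub, intervalIntegral.integral_interval_sub_left] <;>
    exact intervalIntegrable_of_locallyIntegrable hf _ _

lemma isPrimitive_of_hasDerivAt {F f : ℝ → ℂ} (hF : ∀ x, HasDerivAt F (f x) x)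
    (hf : Continuous f) : IsPrimitive F f :=
  ⟨hf.locallyIntegrable, fun x y =>
    (intervalIntegral.integral_eq_sub_of_hasDerivAt (fun t _ => hF t)
      (hf.intervalIntegrable x y)).symm⟩

lemma IsPrimitive.absolutelyContinuousOnInterval {F f : ℝ → ℂ} (h : IsPrimitive F f) (a b : ℝ) :
    AbsolutelyContinuousOnInterval F a b := by
  have hi := intervalIntegrable_of_locallyIntegrable h.1
  have hN := (hi a b).norm.absolutelyContinuousOnInterval_intervalIntegral (c := a) (by simp)
  rw [absolutelyContinuousOnInterval_iff] at hN ⊢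
  intro ε hε
  obtain ⟨δ, hδ, H⟩ := hN ε hε
  refine ⟨δ, hδ, fun E hE hlt => lt_of_le_of_lt (Finset.sum_le_sum fun i _ => ?_) (H E hE hlt)⟩
  rw [dist_comm, dist_eq_norm, h.2, dist_comm, Real.dist_eq,
    intervalIntegral.integral_interval_sub_left (hi _ _).norm (hi _ _).norm]
  exact intervalIntegral.norm_integral_le_abs_integral_norm

lemma IsPrimitive.continuous {F f : ℝ → ℂ} (h : IsPrimitive F f) : Continuous F := by
  have : F = fun x => F 0 + ∫ t in (0 : ℝ)..x, f t := by
    funext x; rw [← h.2 0 x]; ring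
  rw [this]
  exact continuous_const.add
    (intervalIntegral.continuous_primitive (intervalIntegrable_of_locallyIntegrable h.1) 0)

lemma IsPrimitive.ae_hasDerivAt {F f : ℝ → ℂ} (h : IsPrimitive F f) :
    ∀ᵐ x, HasDerivAt F (f x) x := by
  filter_upwards [LocallyIntegrable.ae_hasDerivAt_integral h.1] with x hx
  have : F = fun x => F 0 + ∫ t in (0 : ℝ)..x, f t := by
    funext x; rw [← h.2 0 x]; ring
  rw [this]
  exact (hx 0).const_add _

/-- An absolutely continuous function with derivative zero almost everywhere is constant; this
yields the product rule for primitives. -/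
lemma IsPrimitive.smul_of_contDiff {F f : ℝ → ℂ} (h : IsPrimitive F f) {A A' : ℝ → ℂ}
    (hA : ∀ x, HasDerivAt A (A' x) x) (hA' : Continuous A') :
    IsPrimitive (fun x => A x * F x) (fun x => A' x * F x + A x * f x) := by
  have hAc : Continuous A := continuous_iff_continuousAt.2 fun x => (hA x).continuousAt
  have hloc : LocallyIntegrable (fun x => A' x * F x + A x * f x) volume := by
    refine (hA'.mul h.continuous).locallyIntegrable.add ?_
    have := h.1.locallyIntegrableOn Set.univ
    rw [← locallyIntegrableOn_univ]
    exact this.continuousOn_mul hAc.continuousOn isOpen_univ.isLocallyClosed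
  refine ⟨hloc, fun x y => ?_⟩
  have hP := isPrimitive_intervalIntegral hloc 0
  have h1 : ContDiff ℝ 1 A := by
    rw [contDiff_one_iff_deriv]
    refine ⟨fun x => (hA x).differentiableAt, ?_⟩
    rwa [show deriv A = A' from funext fun x => (hA x).deriv]
  have hac : AbsolutelyContinuousOnInterval (fun x => A x * F x) x y :=
    h1.contDiffOn.absolutelyContinuousOnInterval.smul (h.absolutelyContinuousOnInterval x y)
  have hsub := hac.sub (hP.absolutelyContinuousOnInterval x y)
  obtain ⟨C, hC⟩ := hsub.const_of_ae_hasDerivAt_zero (by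
    filter_upwards [h.ae_hasDerivAt, hP.ae_hasDerivAt] with t ht1 ht2 _
    have := ((hA t).mul ht1).sub ht2
    rwa [sub_self] at this)
  have hx := hC x (by simp)
  have hy := hC y (by simp)
  rw [← hP.2 x y]
  simp only [Pi.sub_apply] at hx hy
  linear_combination hy - hx

lemma IsPrimitive.add {F f G g : ℝ → ℂ} (hF : IsPrimitive F f) (hG : IsPrimitive G g) :
    IsPrimitive (fun x => F x + G x) (fun x => f x + g x) := by
  refine ⟨hF.1.add hG.1, fun x y => ?_⟩
  rw [intervalIntegral.integral_add (intervalIntegrable_of_locallyIntegrable hF.1 _ _)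
    (intervalIntegrable_of_locallyIntegrable hG.1 _ _), ← hF.2, ← hG.2]
  ring

lemma exists_pos_forall_notMem_tsupport {θ : ℝ → ℝ} (hs : HasCompactSupport θ) :
    ∃ R : ℝ, 0 < R ∧ ∀ x, R ≤ |x| → x ∉ tsupport θ := by
  obtain ⟨R, hR⟩ := hs.isCompact.isBounded.subset_closedBall 0
  refine ⟨max R 0 + 1, by positivity, fun x hx hm => ?_⟩
  have := hR hm
  rw [Metric.mem_closedBall, dist_zero_right, Real.norm_eq_abs] at this
  linarith [le_max_left R 0]

lemma IsPrimitive.hasWeakDeriv {F f : ℝ → ℂ} (h : IsPrimitive F f) : HasWeakDeriv F f := by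
  refine ⟨h.continuous.locallyIntegrable, h.1, fun θ hθ hs => ?_⟩
  have hd : ∀ x, HasDerivAt (fun x => (θ x : ℂ)) ((deriv θ x : ℝ) : ℂ) x := fun x =>
    ((hθ.differentiable (by simp)) x).hasDerivAt.ofReal_comp
  have hc : Continuous (deriv θ) := hθ.continuous_deriv (by simp)
  have hp := h.smul_of_contDiff hd (Complex.continuous_ofReal.comp hc)
  have hs' : HasCompactSupport (deriv θ) := hs.deriv
  obtain ⟨R, hR0, hR⟩ := exists_pos_forall_notMem_tsupport hs
  have hz : ∀ x, R ≤ |x| → θ x = 0 ∧ deriv θ x = 0 := fun x hx =>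
    ⟨image_eq_zero_of_notMem_tsupport (hR x hx),
      image_eq_zero_of_notMem_tsupport fun hm => hR x hx (tsupport_deriv_subset hm)⟩
  have i1 : Integrable (fun x => deriv θ x • F x) :=
    (hc.smul h.continuous).integrable_of_hasCompactSupport (hs'.smul_right)
  have i2 : Integrable (fun x => θ x • f x) :=
    h.1.integrable_smul_left_of_hasCompactSupport hθ.continuous hs
  rw [eq_neg_iff_add_eq_zero, ← integral_add i1 i2,
    ← setIntegral_eq_integral_of_forall_compl_eq_zero (s := Set.Ioc (-R) R),
    ← intervalIntegral.integral_of_le (by linarith)]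
  · have := hp.2 (-R) R
    simp only [Complex.real_smul]
    rw [← this]
    simp [(hz R (le_abs_self R)).1, (hz (-R) (by rw [abs_neg]; exact le_abs_self R)).1]
  · intro x hx
    have hx' : R ≤ |x| := by
      by_contra! hcon
      have := abs_lt.1 hcon
      exact hx ⟨this.1, this.2.le⟩
    simp [hz x hx']

lemma hasWeakDeriv_unique {u v v' : ℝ → ℂ} (h : HasWeakDeriv u v) (h' : HasWeakDeriv u v') :
    v =ᵐ[volume] v' :=
  ae_eq_of_integral_contDiff_smul_eq h.2.1 h'.2.1 fun g hg hs =>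
    neg_injective ((h.2.2 g hg hs).symm.trans (h'.2.2 g hg hs))

lemma HasWeakDeriv.congr_ae {u u' v v' : ℝ → ℂ} (h : HasWeakDeriv u v)
    (hu : u =ᵐ[volume] u') (hv : v =ᵐ[volume] v') : HasWeakDeriv u' v' := by
  refine ⟨h.1.congr hu, h.2.1.congr hv, fun θ hθ hs => ?_⟩
  have e1 : ∫ x, deriv θ x • u' x = ∫ x, deriv θ x • u x :=
    integral_congr_ae (hu.mono fun x hx => by simp [hx])
  have e2 : ∫ x, θ x • v' x = ∫ x, θ x • v x :=
    integral_congr_ae (hv.mono fun x hx => by simp [hx])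
  rw [e1, e2, h.2.2 θ hθ hs]

/-- A smooth compactly supported function of mean zero is the derivative of a smooth compactly
supported function. -/
lemma exists_deriv_eq_of_integral_eq_zero {g : ℝ → ℝ} (hg : ContDiff ℝ (⊤ : ℕ∞) g)
    (hs : HasCompactSupport g) (h0 : ∫ x, g x = 0) :
    ∃ θ : ℝ → ℝ, ContDiff ℝ (⊤ : ℕ∞) θ ∧ HasCompactSupport θ ∧ deriv θ = g := by
  obtain ⟨R, hR⟩ := hs.isCompact.isBounded.subset_closedBall 0
  have hz : ∀ x, x ∉ Set.Icc (-R) R → g x = 0 := by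
    intro x hx
    refine image_eq_zero_of_notMem_tsupport fun hmem => hx ?_
    have := hR hmem
    rw [Metric.mem_closedBall, dist_zero_right, Real.norm_eq_abs] at this
    exact abs_le.1 this
  have hd : ∀ x, HasDerivAt (fun x => ∫ t in (-R)..x, g t) (g x) x := fun x =>
    hg.continuous.integral_hasStrictDerivAt _ _ |>.hasDerivAt
  have hde : deriv (fun x => ∫ t in (-R)..x, g t) = g := funext fun x => (hd x).deriv
  refine ⟨fun x => ∫ t in (-R)..x, g t, ?_, ?_, hde⟩
  · rw [contDiff_infty_iff_deriv, hde]
    exact ⟨fun x => (hd x).differentiableAt, hg⟩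
  · refine HasCompactSupport.intro (isCompact_Icc (a := -R) (b := R)) fun x hx => ?_
    rcases lt_or_ge x (-R) with hlt | hge
    · rw [intervalIntegral.integral_symm, intervalIntegral.integral_of_le hlt.le,
        setIntegral_congr_ae (g := fun _ => (0 : ℝ)) measurableSet_Ioc]
      · simp
      · have : ∀ᵐ t : ℝ, t ≠ -R := by simp [ae_iff, measure_singleton]
        filter_upwards [this] with t ht hm
        exact hz t fun hI => ht (le_antisymm hm.2 hI.1)
    · have hlt : R < x := by
        by_contra hcon
        exact hx ⟨hge, not_lt.1 hcon⟩
      rw [intervalIntegral.integral_of_le hge]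
      rw [← h0, setIntegral_eq_integral_of_ae_compl_eq_zero]
      have : ∀ᵐ t : ℝ, t ≠ -R := by simp [ae_iff, measure_singleton]
      filter_upwards [this] with t ht hm
      exact hz t fun hI => hm ⟨lt_of_le_of_ne hI.1 ht.symm, hI.2.trans hlt.le⟩

/-- The lemma of du Bois-Reymond: a function with a weak derivative agrees almost everywhere with
a primitive of that derivative. -/
lemma HasWeakDeriv.exists_isPrimitive {u v : ℝ → ℂ} (h : HasWeakDeriv u v) :
    ∃ F, IsPrimitive F v ∧ u =ᵐ[volume] F := by
  set F₀ : ℝ → ℂ := fun x => 0 + ∫ t in (0 : ℝ)..x, v t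
  have hF₀ : IsPrimitive F₀ v := isPrimitive_intervalIntegral h.2.1 0
  have hw := hF₀.hasWeakDeriv
  let φ : ContDiffBump (0 : ℝ) := default
  set ρ : ℝ → ℝ := φ.normed volume
  have hρ : ContDiff ℝ (⊤ : ℕ∞) ρ := φ.contDiff_normed
  have hρs : HasCompactSupport ρ := φ.hasCompactSupport_normed
  have hρi : ∫ x, ρ x = 1 := φ.integral_normed
  -- The difference `u - F₀` annihilates all derivatives of test functions.
  have hloc : LocallyIntegrable (fun x => u x - F₀ x) volume := h.1.sub hw.1
  have key : ∀ θ : ℝ → ℝ, ContDiff ℝ (⊤ : ℕ∞) θ → HasCompactSupport θ →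
      ∫ x, deriv θ x • (u x - F₀ x) = 0 := by
    intro θ hθ hs
    have hc : Continuous (deriv θ) := hθ.continuous_deriv (by simp)
    simp only [smul_sub]
    rw [integral_sub, h.2.2 θ hθ hs, hw.2.2 θ hθ hs, sub_self]
    · exact h.1.integrable_smul_left_of_hasCompactSupport hc hs.deriv
    · exact hw.1.integrable_smul_left_of_hasCompactSupport hc hs.deriv
  set c : ℂ := ∫ x, ρ x • (u x - F₀ x)
  have hae : ∀ᵐ x, (u x - F₀ x) - c = 0 := by
    refine ae_eq_zero_of_integral_contDiff_smul_eq_zero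
      (hloc.sub (continuous_const.locallyIntegrable)) fun g hg hs => ?_
    have ig : Integrable g := hg.continuous.integrable_of_hasCompactSupport hs
    have iρ : Integrable ρ := hρ.continuous.integrable_of_hasCompactSupport hρs
    have igw := hloc.integrable_smul_left_of_hasCompactSupport hg.continuous hs
    have iρw := hloc.integrable_smul_left_of_hasCompactSupport hρ.continuous hρs
    obtain ⟨θ, hθ, hθs, hθd⟩ := exists_deriv_eq_of_integral_eq_zero
      (g := fun x => g x - (∫ y, g y) * ρ x) (hg.sub (contDiff_const.mul hρ))
      (hs.sub (hρs.mul_left)) (by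
        rw [integral_sub ig (iρ.const_mul _), integral_const_mul, hρi]; ring)
    have hk := key θ hθ hθs
    rw [hθd] at hk
    simp only [sub_smul, mul_smul] at hk
    rw [integral_sub igw (Integrable.fun_smul _ iρw), integral_smul] at hk
    have e : ∀ x, g x • ((u x - F₀ x) - c) = g x • (u x - F₀ x) - g x • c := fun x => smul_sub _ _ _
    simp only [e]
    rw [integral_sub igw (ig.smul_const c), integral_smul_const]
    exact hk
  refine ⟨fun x => F₀ x + c, ⟨h.2.1, fun x y => ?_⟩, ?_⟩
  · rw [← hF₀.2 x y]; ring
  · filter_upwards [hae] with x hx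
    linear_combination hx

/-- A square integrable primitive of a square integrable function is bounded. -/
lemma IsPrimitive.bounded {F f : ℝ → ℂ} (h : IsPrimitive F f) (hF : MemLp F 2 volume)
    (hf : MemLp f 2 volume) : ∃ C : ℝ, ∀ x, ‖F x‖ ≤ C := by
  have iF : Integrable fun x => ‖F x‖ ^ 2 := (memLp_two_iff_integrable_sq_norm hF.1).1 hF
  have jf : Integrable fun x => ‖f x‖ ^ 2 := (memLp_two_iff_integrable_sq_norm hf.1).1 hf
  refine ⟨(1 + ∫ t, ‖F t‖ ^ 2) + (1 + ∫ t, ‖f t‖ ^ 2), fun x => ?_⟩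
  have hle : x ≤ x + 1 := by linarith
  have hfi := intervalIntegrable_of_locallyIntegrable h.1
  have main : ∀ g : ℝ → ℂ, (∀ a b, IntervalIntegrable g volume a b) →
      Integrable (fun t => ‖g t‖ ^ 2) →
      ∫ t in x..(x + 1), ‖g t‖ ≤ 1 + ∫ t, ‖g t‖ ^ 2 := by
    intro g hg ig
    calc ∫ t in x..(x + 1), ‖g t‖ ≤ ∫ t in x..(x + 1), (1 + ‖g t‖ ^ 2) := by
          refine intervalIntegral.integral_mono_on hle (hg _ _).norm
            (intervalIntegrable_const.add ig.intervalIntegrable) fun t _ => ?_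
          nlinarith [sq_nonneg (‖g t‖ - 1), norm_nonneg (g t)]
      _ = 1 + ∫ t in x..(x + 1), ‖g t‖ ^ 2 := by
          rw [intervalIntegral.integral_add intervalIntegrable_const ig.intervalIntegrable]
          simp
      _ ≤ 1 + ∫ t, ‖g t‖ ^ 2 := by
          gcongr
          rw [intervalIntegral.integral_of_le hle]
          exact setIntegral_le_integral ig (Eventually.of_forall fun t => by positivity)
  -- Average the bound `‖F x‖ ≤ ‖F y‖ + ∫ ‖f‖` over `y ∈ [x, x + 1]`.
  have pt : ∀ y ∈ Set.Icc x (x + 1), ‖F x‖ ≤ ‖F y‖ + ∫ t in x..(x + 1), ‖f t‖ := by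
    intro y hy
    have e : F x = F y - ∫ t in x..y, f t := by rw [← h.2 x y]; ring
    have b1 : ‖∫ t in x..y, f t‖ ≤ ∫ t in x..y, ‖f t‖ :=
      intervalIntegral.norm_integral_le_integral_norm hy.1
    have b2 : ∫ t in x..y, ‖f t‖ ≤ ∫ t in x..(x + 1), ‖f t‖ :=
      intervalIntegral.integral_mono_interval le_rfl hy.1 hy.2
        (Eventually.of_forall fun t => norm_nonneg _) (hfi _ _).norm
    calc ‖F x‖ = ‖F y - ∫ t in x..y, f t‖ := by rw [← e]
      _ ≤ ‖F y‖ + ‖∫ t in x..y, f t‖ := norm_sub_le _ _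
      _ ≤ _ := by linarith
  have hcont := h.continuous.norm
  have avg : ∫ y in x..(x + 1), ‖F x‖ ≤
      ∫ y in x..(x + 1), (‖F y‖ + ∫ t in x..(x + 1), ‖f t‖) :=
    intervalIntegral.integral_mono_on hle intervalIntegrable_const
      ((hcont.intervalIntegrable _ _).add intervalIntegrable_const) pt
  rw [intervalIntegral.integral_add (hcont.intervalIntegrable _ _) intervalIntegrable_const] at avg
  simp only [intervalIntegral.integral_const, add_sub_cancel_left, one_smul] at avg
  linarith [main F (fun a b => h.continuous.intervalIntegrable a b) iF, main f hfi jf]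

/-! ### Weighted spaces and regular representatives -/

lemma one_le_sqrt_weight (x : ℝ) : 1 ≤ Real.sqrt (1 + x ^ 2) :=
  Real.one_le_sqrt.2 (by nlinarith [sq_nonneg x])

lemma continuous_weight : Continuous fun x : ℝ => Real.sqrt (1 + x ^ 2) := by fun_prop

lemma MemL21.congr_ae {f g : ℝ → ℂ} (hf : MemL21 f) (h : f =ᵐ[volume] g) : MemL21 g :=
  (memLp_congr_ae (h.mono fun x hx => by simp [hx])).1 hf

lemma MemL21.of_le {f g : ℝ → ℂ} (hg : MemL21 g) (hf : Continuous f) (C : ℝ)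
    (h : ∀ x, ‖f x‖ ≤ C * ‖g x‖) : MemL21 f := by
  refine MemLp.of_le_mul (c := C) hg (continuous_weight.smul hf).aestronglyMeasurable
    (Eventually.of_forall fun x => ?_)
  rw [norm_smul, norm_smul]
  calc _ ≤ ‖Real.sqrt (1 + x ^ 2)‖ * (C * ‖g x‖) := by gcongr; exact h x
    _ = _ := by ring

lemma MemL21.add {f g : ℝ → ℂ} (hf : MemL21 f) (hg : MemL21 g) :
    MemL21 fun x => f x + g x := by
  unfold MemL21 at *
  simp only [smul_add]
  exact MemLp.add hf hg

lemma MemL21.aestronglyMeasurable {f : ℝ → ℂ} (hf : MemL21 f) :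
    AEStronglyMeasurable f volume := by
  have h1 : AEStronglyMeasurable (fun x : ℝ => (Real.sqrt (1 + x ^ 2))⁻¹) volume := by
    refine (continuous_weight.inv₀ fun x => ?_).aestronglyMeasurable
    linarith [one_le_sqrt_weight x]
  refine (h1.smul hf.1).congr (Eventually.of_forall fun x => ?_)
  have : Real.sqrt (1 + x ^ 2) ≠ 0 := by linarith [one_le_sqrt_weight x]
  simp [this]

lemma MemL21.memLp {f : ℝ → ℂ} (hf : MemL21 f) : MemLp f 2 volume := by
  refine MemLp.of_le hf hf.aestronglyMeasurable (Eventually.of_forall fun x => ?_)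
  rw [norm_smul, Real.norm_of_nonneg (by positivity)]
  nlinarith [one_le_sqrt_weight x, norm_nonneg (f x)]

lemma norm_sqrt_weight_smul_sq (x : ℝ) (z : ℂ) :
    ‖Real.sqrt (1 + x ^ 2) • z‖ ^ 2 = (1 + x ^ 2) * ‖z‖ ^ 2 := by
  rw [norm_smul, mul_pow, Real.norm_of_nonneg (by positivity), Real.sq_sqrt (by positivity)]

lemma MemL21.integrable_weight {f : ℝ → ℂ} (hf : MemL21 f) :
    Integrable fun x : ℝ => (1 + x ^ 2) * ‖f x‖ ^ 2 := by
  have := (memLp_two_iff_integrable_sq_norm hf.1).1 hf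
  simpa only [norm_sqrt_weight_smul_sq] using this

lemma memL21_of_integrable_weight {f : ℝ → ℂ} (hf : Continuous f)
    (h : Integrable fun x : ℝ => (1 + x ^ 2) * ‖f x‖ ^ 2) : MemL21 f := by
  refine (memLp_two_iff_integrable_sq_norm (continuous_weight.smul hf).aestronglyMeasurable).2 ?_
  exact h.congr (Eventually.of_forall fun x => (norm_sqrt_weight_smul_sq x (f x)).symm)

/-- `L^{2,1}(ℝ) ⊆ L¹(ℝ)`, because `2 |f| ≤ ⟨x⟩² |f|² + ⟨x⟩⁻²`. -/
lemma MemL21.integrable {f : ℝ → ℂ} (hf : MemL21 f) : Integrable f := by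
  refine (hf.integrable_weight.add integrable_inv_one_add_sq).mono' hf.aestronglyMeasurable
    (Eventually.of_forall fun x => ?_)
  have hp : (0 : ℝ) < 1 + x ^ 2 := by positivity
  have h1 : (1 + x ^ 2) * ‖f x‖ ^ 2 + (1 + x ^ 2)⁻¹ - 2 * ‖f x‖
      = (1 + x ^ 2)⁻¹ * ((1 + x ^ 2) * ‖f x‖ - 1) ^ 2 := by
    field_simp
    ring
  have h2 : 0 ≤ (1 + x ^ 2)⁻¹ * ((1 + x ^ 2) * ‖f x‖ - 1) ^ 2 := by positivity
  simp only [Pi.add_apply]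
  linarith [norm_nonneg (f x)]

lemma MemL21.comp_neg {f : ℝ → ℂ} (hf : MemL21 f) : MemL21 fun x => conj (f (-x)) := by
  have h1 : MemLp (fun x : ℝ => Real.sqrt (1 + (-x) ^ 2) • f (-x)) 2 volume :=
    hf.comp_measurePreserving (Measure.measurePreserving_neg volume)
  have h2 : AEStronglyMeasurable (fun x => conj (f (-x))) volume :=
    Complex.continuous_conj.comp_aestronglyMeasurable
      (hf.aestronglyMeasurable.comp_measurePreserving (Measure.measurePreserving_neg volume))
  refine MemLp.of_le h1 (continuous_weight.aestronglyMeasurable.smul h2)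
    (Eventually.of_forall fun x => ?_)
  simp

/-- The properties of the continuously differentiable representative `U` of a potential in
`H²(ℝ) ∩ H^{1,1}(ℝ)`: `V` is the derivative of `U`, and `w` that of `V`. -/
structure IsRegular (U V w : ℝ → ℂ) : Prop where
  hasDerivAt : ∀ x, HasDerivAt U (V x) x
  isPrimitive : IsPrimitive V w
  memL21 : MemL21 U
  memL21' : MemL21 V
  memLp : MemLp w 2 volume
  bounded : ∃ C : ℝ, ∀ x, ‖U x‖ ≤ C
  bounded' : ∃ C : ℝ, ∀ x, ‖V x‖ ≤ C

lemma IsRegular.continuous {U V w : ℝ → ℂ} (h : IsRegular U V w) : Continuous U :=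
  continuous_iff_continuousAt.2 fun x => (h.hasDerivAt x).continuousAt

lemma exists_isRegular {u : ℝ → ℂ} (h2 : MemH2 u) (h11 : MemH11 u) :
    ∃ U V w, u =ᵐ[volume] U ∧ IsRegular U V w := by
  obtain ⟨v, w, huv, hvw, -, hv2, hw2⟩ := h2
  obtain ⟨v', huv', hu21, hv21⟩ := h11
  obtain ⟨V, hV, hvV⟩ := hvw.exists_isPrimitive
  obtain ⟨U, hU, huU⟩ := huv.exists_isPrimitive
  have hd : ∀ x, HasDerivAt U (V x) x := by
    have e : U = fun x => U 0 + ∫ t in (0 : ℝ)..x, V t := by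
      funext x
      rw [← intervalIntegral.integral_congr_ae (hvV.mono fun t ht _ => ht), ← hU.2 0 x]
      ring
    intro x
    rw [e]
    exact ((hV.continuous.integral_hasStrictDerivAt _ _).hasDerivAt).const_add _
  have hU21 : MemL21 U := hu21.congr_ae huU
  have hV21 : MemL21 V := hv21.congr_ae ((hasWeakDeriv_unique huv' huv).trans hvV)
  exact ⟨U, V, w, huU, hd, hV, hU21, hV21, hw2,
    (isPrimitive_of_hasDerivAt hd hV.continuous).bounded hU21.memLp hV21.memLp,
    hV.bounded hV21.memLp hw2⟩

lemma MemH2.congr_ae {u u' : ℝ → ℂ} (h : MemH2 u) (e : u =ᵐ[volume] u') : MemH2 u' := by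
  obtain ⟨v, w, h1, h2, h3, h4, h5⟩ := h
  exact ⟨v, w, h1.congr_ae e (ae_eq_refl _), h2, (memLp_congr_ae e).1 h3, h4, h5⟩

lemma MemH11.congr_ae {u u' : ℝ → ℂ} (h : MemH11 u) (e : u =ᵐ[volume] u') : MemH11 u' := by
  obtain ⟨v, h1, h2, h3⟩ := h
  exact ⟨v, h1.congr_ae e (ae_eq_refl _), h2.congr_ae e, h3⟩

lemma coeff_mulVec (u : ℝ → ℂ) (l : ℂ) (x : ℝ) (y : Fin 2 → ℂ) :
    (coeff u l x).mulVec y = ![-Complex.I * l ^ 2 * y 0 + l * u x * y 1,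
      Complex.I * l ^ 2 * y 1 - l * conj (u x) * y 0] := by
  funext i
  fin_cases i
  · simp [coeff, sigma3, potential, Matrix.mulVec, dotProduct, Fin.sum_univ_two]
  · simp [coeff, sigma3, potential, Matrix.mulVec, dotProduct, Fin.sum_univ_two]
    ring

lemma IsSolution.congr_ae {u u' : ℝ → ℂ} (e : u =ᵐ[volume] u') {l : ℂ} {ψ : ℝ → Fin 2 → ℂ}
    (h : IsSolution u l ψ) : IsSolution u' l ψ := by
  have e' : (fun t => (coeff u l t).mulVec (ψ t)) =ᵐ[volume]
      fun t => (coeff u' l t).mulVec (ψ t) := by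
    filter_upwards [e] with t ht
    simp only [coeff_mulVec, ht]
  refine ⟨h.1, fun x y => ⟨((h.2 x y).1).congr_ae (ae_restrict_of_ae e'), ?_⟩⟩
  rw [(h.2 x y).2]
  exact intervalIntegral.integral_congr_ae (e'.mono fun t ht _ => ht)

lemma isSolution_congr_ae {u u' : ℝ → ℂ} (e : u =ᵐ[volume] u') (l : ℂ) :
    IsSolution u l = IsSolution u' l :=
  funext fun _ => propext ⟨IsSolution.congr_ae e, IsSolution.congr_ae e.symm⟩

lemma jostMinus_congr_ae {u u' : ℝ → ℂ} (e : u =ᵐ[volume] u') : jostMinus u = jostMinus u' := by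
  funext l
  have : IsJostMinus u l = IsJostMinus u' l := by
    funext f; simp only [IsJostMinus, isSolution_congr_ae e l]
  unfold jostMinus
  rw [this]

lemma jostPlus_congr_ae {u u' : ℝ → ℂ} (e : u =ᵐ[volume] u') : jostPlus u = jostPlus u' := by
  funext l
  have : IsJostPlus u l = IsJostPlus u' l := by
    funext f; simp only [IsJostPlus, isSolution_congr_ae e l]
  unfold jostPlus
  rw [this]

lemma minusSolution_congr_ae {u u' : ℝ → ℂ} (e : u =ᵐ[volume] u') (l : ℂ) :
    minusSolution u l = minusSolution u' l := by
  funext x; simp only [minusSolution, jostMinus_congr_ae e]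

lemma scatA_congr_ae {u u' : ℝ → ℂ} (e : u =ᵐ[volume] u') : scatA u = scatA u' := by
  funext l
  simp only [scatA, minusSolution, plusSolution, jostMinus_congr_ae e, jostPlus_congr_ae e]

/-! ### Existence of the Jost functions -/

/-- The Jost problem at `-∞` in components: for continuous `u`, the pair `(p, q)` is the Jost
function `φ₋(·; l)`. -/
structure IsMinusPair (u : ℝ → ℂ) (l : ℂ) (p q : ℝ → ℂ) : Prop where
  deriv_fst : ∀ x, HasDerivAt p (l * u x * q x) x
  deriv_snd : ∀ x, HasDerivAt q (2 * Complex.I * l ^ 2 * q x - l * conj (u x) * p x) x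
  bounded : ∃ C : ℝ, ∀ x, ‖p x‖ ≤ C ∧ ‖q x‖ ≤ C
  tendsto_fst : Tendsto p atBot (𝓝 1)
  tendsto_snd : Tendsto q atBot (𝓝 0)

lemma IsMinusPair.continuous_fst {u : ℝ → ℂ} {l : ℂ} {p q : ℝ → ℂ} (h : IsMinusPair u l p q) :
    Continuous p := continuous_iff_continuousAt.2 fun x => (h.deriv_fst x).continuousAt

lemma IsMinusPair.continuous_snd {u : ℝ → ℂ} {l : ℂ} {p q : ℝ → ℂ} (h : IsMinusPair u l p q) :
    Continuous q := continuous_iff_continuousAt.2 fun x => (h.deriv_snd x).continuousAt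

section Primitive

variable {E : Type*} [NormedAddCommGroup E] [NormedSpace ℝ E]

lemma hasDerivAt_integral_Iic [CompleteSpace E] {h : ℝ → E} (hc : Continuous h)
    (hi : ∀ x, IntegrableOn h (Set.Iic x)) (x : ℝ) :
    HasDerivAt (fun x => ∫ t in Set.Iic x, h t) (h x) x := by
  have e : (fun x => ∫ t in Set.Iic x, h t) =
      fun x => (∫ t in Set.Iic (0 : ℝ), h t) + ∫ t in (0 : ℝ)..x, h t := by
    funext y
    rw [← intervalIntegral.integral_Iic_sub_Iic (hi 0) (hi y)]
    abel
  rw [e]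
  exact ((hc.integral_hasStrictDerivAt _ _).hasDerivAt).const_add _

lemma tendsto_integral_Iic_atBot {h : ℝ → E} (hi : Integrable h) :
    Tendsto (fun x => ∫ t in Set.Iic x, h t) atBot (𝓝 0) := by
  have h1 := intervalIntegral_tendsto_integral_Iic (μ := volume) (f := h) 0 hi.integrableOn
    tendsto_id
  have h2 := h1.const_sub (∫ t in Set.Iic (0 : ℝ), h t)
  rw [sub_self] at h2
  refine h2.congr fun x => ?_
  rw [id, ← intervalIntegral.integral_Iic_sub_Iic hi.integrableOn hi.integrableOn]
  abel

end Primitive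

/-- The solution operator at `-∞` of `J' = c J + a f`, for `Re c ≤ 0`. -/
noncomputable def duhamel (c : ℂ) (a f : ℝ → ℂ) (x : ℝ) : ℂ :=
  Complex.exp (c * x) * ∫ y in Set.Iic x, Complex.exp (-c * y) * (a y * f y)

section Duhamel

variable {c : ℂ} {a f : ℝ → ℂ}

lemma integrableOn_duhamel (hc : c.re ≤ 0) (ha : Continuous a) (hf : Continuous f)
    (haf : Integrable fun y => a y * f y) (x : ℝ) :
    IntegrableOn (fun y : ℝ => Complex.exp (-c * y) * (a y * f y)) (Set.Iic x) := by
  refine Integrable.mono' ((haf.norm.const_mul (Real.exp (-c.re * x))).integrableOn)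
    (Continuous.aestronglyMeasurable (by fun_prop)) ?_
  refine (ae_restrict_iff' measurableSet_Iic).2 (Eventually.of_forall fun y hy => ?_)
  rw [norm_mul, Complex.norm_exp]
  gcongr
  simp only [Complex.mul_re, Complex.neg_re, Complex.ofReal_re, Complex.neg_im, Complex.ofReal_im]
  have : y ≤ x := hy
  nlinarith

lemma hasDerivAt_duhamel (hc : c.re ≤ 0) (ha : Continuous a) (hf : Continuous f)
    (haf : Integrable fun y => a y * f y) (x : ℝ) :
    HasDerivAt (duhamel c a f) (c * duhamel c a f x + a x * f x) x := by
  have h1 : HasDerivAt (fun x : ℝ => Complex.exp (c * x)) (Complex.exp (c * x) * c) x := by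
    have := ((Complex.ofRealCLM.hasDerivAt (x := x)).const_mul c).cexp
    simpa using this
  have h2 := hasDerivAt_integral_Iic
    (h := fun y : ℝ => Complex.exp (-c * y) * (a y * f y)) (by fun_prop)
    (integrableOn_duhamel hc ha hf haf) x
  refine (h1.mul h2).congr_deriv ?_
  have e : Complex.exp (c * x) * Complex.exp (-c * x) = 1 := by
    rw [← Complex.exp_add]; simp
  simp only [duhamel]
  linear_combination (a x * f x) * e

lemma norm_duhamel_le (hc : c.re ≤ 0) (haf : Integrable fun y => a y * f y) (x : ℝ) :
    ‖duhamel c a f x‖ ≤ ∫ y in Set.Iic x, ‖a y * f y‖ := by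
  rw [duhamel, ← integral_const_mul]
  refine norm_integral_le_of_norm_le haf.norm.integrableOn ?_
  refine (ae_restrict_iff' measurableSet_Iic).2 (Eventually.of_forall fun y hy => ?_)
  rw [norm_mul, norm_mul, ← mul_assoc, Complex.norm_exp, Complex.norm_exp, ← Real.exp_add]
  refine mul_le_of_le_one_left (norm_nonneg _) (Real.exp_le_one_iff.2 ?_)
  simp only [Complex.mul_re, Complex.neg_re, Complex.ofReal_re, Complex.neg_im, Complex.ofReal_im]
  have : y ≤ x := hy
  nlinarith

lemma duhamel_sub (hc : c.re ≤ 0) (ha : Continuous a) {f g : ℝ → ℂ} (hf : Continuous f)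
    (hg : Continuous g) (haf : Integrable fun y => a y * f y)
    (hag : Integrable fun y => a y * g y) (x : ℝ) :
    duhamel c a f x - duhamel c a g x = duhamel c a (fun y => f y - g y) x := by
  simp only [duhamel]
  rw [← mul_sub, ← integral_sub (integrableOn_duhamel hc ha hf haf x)
    (integrableOn_duhamel hc ha hg hag x)]
  simp only [mul_sub]

end Duhamel

section Existence

variable {u : ℝ → ℂ}

/-- The mass of `|u|` to the left of `x`. -/
noncomputable def leftMass (u : ℝ → ℂ) (x : ℝ) : ℝ := ∫ y in Set.Iic x, ‖u y‖

lemma leftMass_nonneg (x : ℝ) : 0 ≤ leftMass u x := integral_nonneg fun _ => norm_nonneg _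

lemma leftMass_le (hi : Integrable u) (x : ℝ) : leftMass u x ≤ ∫ y, ‖u y‖ :=
  setIntegral_le_integral hi.norm (Eventually.of_forall fun _ => norm_nonneg _)

lemma hasDerivAt_leftMass (hu : Continuous u) (hi : Integrable u) (x : ℝ) :
    HasDerivAt (leftMass u) ‖u x‖ x :=
  hasDerivAt_integral_Iic hu.norm (fun _ => hi.norm.integrableOn) x

lemma continuous_leftMass (hu : Continuous u) (hi : Integrable u) : Continuous (leftMass u) :=
  continuous_iff_continuousAt.2 fun x => (hasDerivAt_leftMass hu hi x).continuousAt

lemma tendsto_leftMass (hi : Integrable u) : Tendsto (leftMass u) atBot (𝓝 0) :=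
  tendsto_integral_Iic_atBot hi.norm

lemma integrable_norm_mul_exp_leftMass (hu : Continuous u) (hi : Integrable u) {K : ℝ}
    (hK : 0 < K) : Integrable fun y => ‖u y‖ * Real.exp (K * leftMass u y) := by
  have hc := continuous_leftMass hu hi
  refine (hi.norm.mul_const (Real.exp (K * ∫ y, ‖u y‖))).mono'
    (Continuous.aestronglyMeasurable (by fun_prop)) (Eventually.of_forall fun y => ?_)
  rw [Real.norm_of_nonneg (by positivity)]
  gcongr
  exact leftMass_le hi y

lemma integral_norm_mul_exp_leftMass (hu : Continuous u) (hi : Integrable u) {K : ℝ}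
    (hK : 0 < K) (x : ℝ) :
    ∫ y in Set.Iic x, ‖u y‖ * Real.exp (K * leftMass u y)
      = (Real.exp (K * leftMass u x) - 1) / K := by
  have hd : ∀ y ∈ Set.Iic x, HasDerivAt (fun y => Real.exp (K * leftMass u y) / K)
      (‖u y‖ * Real.exp (K * leftMass u y)) y := fun y _ => by
    refine (((hasDerivAt_leftMass hu hi y).const_mul K).exp.div_const K).congr_deriv ?_
    field_simp
  have ht : Tendsto (fun y => Real.exp (K * leftMass u y) / K) atBot (𝓝 (1 / K)) := by
    have := (((tendsto_leftMass hi).const_mul K).rexp).div_const K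
    simpa using this
  rw [integral_Iic_of_hasDerivAt_of_tendsto' hd
    (integrable_norm_mul_exp_leftMass hu hi hK).integrableOn ht]
  ring

/-- The key estimate for the contraction: in the norm `sup |e^{-K N} f|`, where `N` is the mass of
`|u|` to the left, the Duhamel operator is `O(1 / K)`. -/
lemma norm_exp_mul_duhamel_le (hu : Continuous u) (hi : Integrable u) {K : ℝ} (hK : 0 < K)
    {c : ℂ} (hc : c.re ≤ 0) {a : ℝ → ℂ} {A : ℝ} (hA : 0 ≤ A) (ha : ∀ y, ‖a y‖ ≤ A * ‖u y‖)
    {f : ℝ → ℂ} {M : ℝ} (hM : 0 ≤ M) (hf : ∀ y, ‖f y‖ ≤ M * Real.exp (K * leftMass u y))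
    (haf : Integrable fun y => a y * f y) (x : ℝ) :
    Real.exp (-(K * leftMass u x)) * ‖duhamel c a f x‖ ≤ A / K * M := by
  have h1 : ‖duhamel c a f x‖ ≤ A * M * ((Real.exp (K * leftMass u x) - 1) / K) := by
    refine (norm_duhamel_le hc haf x).trans ?_
    rw [← integral_norm_mul_exp_leftMass hu hi hK, ← integral_const_mul]
    refine setIntegral_mono haf.norm.integrableOn
      ((integrable_norm_mul_exp_leftMass hu hi hK).const_mul _).integrableOn fun y => ?_
    simp only [norm_mul]
    calc ‖a y‖ * ‖f y‖ ≤ (A * ‖u y‖) * (M * Real.exp (K * leftMass u y)) := by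
          gcongr
          · exact ha y
          · exact hf y
      _ = _ := by ring
  have h2 : Real.exp (-(K * leftMass u x)) * Real.exp (K * leftMass u x) = 1 := by
    rw [← Real.exp_add]; simp
  calc _ ≤ Real.exp (-(K * leftMass u x)) *
        (A * M * ((Real.exp (K * leftMass u x) - 1) / K)) := by gcongr
    _ = A / K * M * (Real.exp (-(K * leftMass u x)) * Real.exp (K * leftMass u x)
          - Real.exp (-(K * leftMass u x))) := by ring
    _ ≤ A / K * M * 1 := by
          gcongr
          rw [h2]
          linarith [Real.exp_pos (-(K * leftMass u x))]
    _ = _ := by ring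

open BoundedContinuousFunction in
/-- Existence of `φ₋(·; l)` for `Im l² ≥ 0`, by the contraction principle. -/
theorem exists_isMinusPair (hu : Continuous u) (hi : Integrable u) {l : ℂ}
    (hl : 0 ≤ (l ^ 2).im) : ∃ p q, IsMinusPair u l p q := by
  set K : ℝ := 2 * ‖l‖ + 1 with hKdef
  have hK : 0 < K := by positivity
  set N := leftMass u with hN
  have hNc : Continuous N := continuous_leftMass hu hi
  have hNM : ∀ x, N x ≤ ∫ y, ‖u y‖ := leftMass_le hi
  set M := Real.exp (K * ∫ y, ‖u y‖)
  have hEM : ∀ x, Real.exp (K * N x) ≤ M := fun x =>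
    Real.exp_le_exp.2 (mul_le_mul_of_nonneg_left (hNM x) hK.le)
  set c : ℂ := 2 * Complex.I * l ^ 2 with hc
  have hcre : c.re ≤ 0 := by
    have : c.re = -2 * (l ^ 2).im := by simp [hc, mul_assoc]
    rw [this]; linarith
  have h0re : (0 : ℂ).re ≤ 0 := le_rfl
  set a₁ : ℝ → ℂ := fun y => l * u y with ha₁
  set a₂ : ℝ → ℂ := fun y => -(l * conj (u y)) with ha₂
  have ha₁c : Continuous a₁ := by fun_prop
  have ha₂c : Continuous a₂ := (continuous_const.mul (Complex.continuous_conj.comp hu)).neg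
  have ha₁n : ∀ y, ‖a₁ y‖ ≤ ‖l‖ * ‖u y‖ := fun y => by simp [ha₁]
  have ha₂n : ∀ y, ‖a₂ y‖ ≤ ‖l‖ * ‖u y‖ := fun y => by simp [ha₂]
  have integ : ∀ a : ℝ → ℂ, Continuous a → (∀ y, ‖a y‖ ≤ ‖l‖ * ‖u y‖) → ∀ f : ℝ → ℂ,
      Continuous f → ∀ D : ℝ, (∀ y, ‖f y‖ ≤ D * Real.exp (K * N y)) →
      Integrable fun y => a y * f y := by
    intro a hac han f hf D hD
    refine ((hi.norm.const_mul (‖l‖ * (D * 1))).mul_const M).mono'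
      (hac.mul hf).aestronglyMeasurable (Eventually.of_forall fun y => ?_)
    have hD0 : 0 ≤ D := by
      have := (norm_nonneg _).trans (hD y)
      exact nonneg_of_mul_nonneg_left this (Real.exp_pos _)
    rw [norm_mul]
    calc ‖a y‖ * ‖f y‖ ≤ (‖l‖ * ‖u y‖) * (D * M) := by
          gcongr
          · exact han y
          · exact (hD y).trans (by gcongr; exact hEM y)
      _ = _ := by ring
  -- `e^{K N} g` for a bounded continuous `g`.
  let up : (ℝ →ᵇ ℂ) → ℝ → ℂ := fun g y => (Real.exp (K * N y) : ℂ) * g y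
  have hup : ∀ g, Continuous (up g) := fun g => by
    have := g.continuous
    show Continuous fun y => (Real.exp (K * N y) : ℂ) * g y
    fun_prop
  have hupn : ∀ g y, ‖up g y‖ ≤ ‖g‖ * Real.exp (K * N y) := fun g y => by
    simp only [up, norm_mul, Complex.norm_real, Real.norm_of_nonneg (Real.exp_pos _).le]
    rw [mul_comm]
    gcongr
    exact g.norm_coe_le_norm y
  have hsubn : ∀ g h y, ‖up g y - up h y‖ ≤ dist g h * Real.exp (K * N y) := fun g h y => by
    simp only [up]
    rw [← mul_sub, norm_mul, Complex.norm_real, Real.norm_of_nonneg (Real.exp_pos _).le, mul_comm,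
      ← dist_eq_norm]
    gcongr
    exact dist_coe_le_dist y
  -- One component of the contraction.
  let comp : ∀ c : ℂ, c.re ≤ 0 → ∀ a : ℝ → ℂ, Continuous a → (∀ y, ‖a y‖ ≤ ‖l‖ * ‖u y‖) →
      ∀ z : ℂ, (ℝ →ᵇ ℂ) → (ℝ →ᵇ ℂ) := fun c hc a hac han z g =>
    ofNormedAddCommGroup
      (fun x => (Real.exp (-(K * N x)) : ℂ) * (z + duhamel c a (up g) x))
      (by
        have : Continuous (duhamel c a (up g)) := continuous_iff_continuousAt.2 fun x =>
          (hasDerivAt_duhamel hc hac (hup g)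
            (integ a hac han _ (hup g) _ (hupn g)) x).continuousAt
        fun_prop)
      (‖z‖ + ‖l‖ / K * ‖g‖)
      (fun x => by
        rw [mul_add]
        refine (norm_add_le _ _).trans (add_le_add ?_ ?_)
        · rw [norm_mul, Complex.norm_real, Real.norm_of_nonneg (Real.exp_pos _).le]
          refine mul_le_of_le_one_left (norm_nonneg _) (Real.exp_le_one_iff.2 ?_)
          have := leftMass_nonneg (u := u) x
          have : 0 ≤ K * N x := by positivity
          linarith
        · rw [norm_mul, Complex.norm_real, Real.norm_of_nonneg (Real.exp_pos _).le]
          exact norm_exp_mul_duhamel_le hu hi hK hc (norm_nonneg l) han (norm_nonneg g)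
            (hupn g) (integ a hac han _ (hup g) _ (hupn g)) x)
  have hcomp : ∀ c hc a hac han z g h,
      dist (comp c hc a hac han z g) (comp c hc a hac han z h) ≤ ‖l‖ / K * dist g h := by
    intro c hc a hac han z g h
    refine (dist_le (by positivity)).2 fun x => ?_
    simp only [comp, coe_ofNormedAddCommGroup]
    rw [dist_eq_norm, ← mul_sub, add_sub_add_left_eq_sub, norm_mul, Complex.norm_real,
      Real.norm_of_nonneg (Real.exp_pos _).le,
      duhamel_sub hc hac (hup g) (hup h) (integ a hac han _ (hup g) _ (hupn g))
        (integ a hac han _ (hup h) _ (hupn h))]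
    exact norm_exp_mul_duhamel_le hu hi hK hc (norm_nonneg l) han dist_nonneg
      (hsubn g h) (integ a hac han _ ((hup g).sub (hup h)) _ (hsubn g h)) x
  let T : (ℝ →ᵇ ℂ) × (ℝ →ᵇ ℂ) → (ℝ →ᵇ ℂ) × (ℝ →ᵇ ℂ) := fun g =>
    (comp 0 h0re a₁ ha₁c ha₁n 1 g.2, comp c hcre a₂ ha₂c ha₂n 0 g.1)
  have hT : ContractingWith (1 / 2) T := by
    refine ⟨by norm_num, LipschitzWith.of_dist_le_mul fun g h => ?_⟩
    have hq : ‖l‖ / K ≤ 1 / 2 := by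
      rw [div_le_iff₀ hK]; linarith
    have hq' : (((1 / 2 : NNReal)) : ℝ) = 1 / 2 := by norm_num
    rw [hq', Prod.dist_eq, Prod.dist_eq]
    refine max_le ?_ ?_
    · exact (hcomp 0 h0re a₁ ha₁c ha₁n 1 g.2 h.2).trans
        (mul_le_mul hq (le_max_right _ _) dist_nonneg (by norm_num))
    · exact (hcomp c hcre a₂ ha₂c ha₂n 0 g.1 h.1).trans
        (mul_le_mul hq (le_max_left _ _) dist_nonneg (by norm_num))
  set g := hT.fixedPoint T
  have hg : T g = g := hT.fixedPoint_isFixedPt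
  have hexp : ∀ x, (Real.exp (K * N x) : ℂ) * (Real.exp (-(K * N x)) : ℂ) = 1 := fun x => by
    rw [← Complex.ofReal_mul, ← Real.exp_add]; simp
  have e1 : up g.1 = fun x => 1 + duhamel 0 a₁ (up g.2) x := by
    funext x
    have : g.1 x = (Real.exp (-(K * N x)) : ℂ) * (1 + duhamel 0 a₁ (up g.2) x) := by
      conv_lhs => rw [← hg]
      rfl
    show (Real.exp (K * N x) : ℂ) * g.1 x = _
    rw [this, ← mul_assoc, hexp, one_mul]
  have e2 : up g.2 = duhamel c a₂ (up g.1) := by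
    funext x
    have : g.2 x = (Real.exp (-(K * N x)) : ℂ) * (0 + duhamel c a₂ (up g.1) x) := by
      conv_lhs => rw [← hg]
      rfl
    show (Real.exp (K * N x) : ℂ) * g.2 x = _
    rw [this, ← mul_assoc, hexp, one_mul, zero_add]
  have i1 := integ a₁ ha₁c ha₁n _ (hup g.2) _ (hupn g.2)
  have i2 := integ a₂ ha₂c ha₂n _ (hup g.1) _ (hupn g.1)
  have lim : ∀ c : ℂ, c.re ≤ 0 → ∀ a f : ℝ → ℂ, (Integrable fun y => a y * f y) →
      Tendsto (duhamel c a f) atBot (𝓝 0) := fun c hc a f haf =>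
    squeeze_zero_norm (norm_duhamel_le hc haf) (tendsto_integral_Iic_atBot haf.norm)
  refine ⟨up g.1, up g.2, ⟨fun x => ?_, fun x => ?_, ?_, ?_, ?_⟩⟩
  · have := (hasDerivAt_duhamel h0re ha₁c (hup g.2) i1 x).const_add 1
    rw [← e1] at this
    exact this.congr_deriv (by simp only [ha₁]; ring)
  · have := hasDerivAt_duhamel hcre ha₂c (hup g.1) i2 x
    rw [← e2] at this
    exact this.congr_deriv (by simp only [ha₂, hc]; ring)
  · refine ⟨max (‖g.1‖ * M) (‖g.2‖ * M), fun x => ⟨?_, ?_⟩⟩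
    · refine ((hupn g.1 x).trans ?_).trans (le_max_left _ _)
      gcongr
      exact hEM x
    · refine ((hupn g.2 x).trans ?_).trans (le_max_right _ _)
      gcongr
      exact hEM x
  · rw [e1]
    simpa using (lim 0 h0re a₁ _ i1).const_add 1
  · rw [e2]
    exact lim c hcre a₂ _ i2

end Existence

/-! ### Energy estimates for the Jost functions -/

lemma hasDerivAt_norm_sq {f : ℝ → ℂ} {f' : ℂ} {x : ℝ} (hf : HasDerivAt f f' x) :
    HasDerivAt (fun x => ‖f x‖ ^ 2) (2 * (f' * conj (f x)).re) x := by
  have := hf.norm_sq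
  rwa [Complex.inner] at this

/-- Gronwall's inequality with initial time `-∞`. -/
lemma le_exp_mul_integral_of_deriv_le {E E' n F : ℝ → ℝ} {b : ℝ}
    (hE : ∀ x, HasDerivAt E (E' x) x) (hE0 : ∀ x, 0 ≤ E x) (hlim : Tendsto E atBot (𝓝 0))
    (hn : Continuous n) (hn0 : ∀ x, 0 ≤ n x) (hni : Integrable n)
    (hF : Continuous F) (hF0 : ∀ x, 0 ≤ F x) (hFi : IntegrableOn F (Set.Iic b))
    (h : ∀ x ≤ b, E' x ≤ n x * E x + F x) :
    E b ≤ Real.exp (∫ x, n x) * ∫ x in Set.Iic b, F x := by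
  have step : ∀ a ≤ b, E b ≤ Real.exp (∫ x, n x) * (E a + ∫ x in Set.Iic b, F x) := by
    intro a hab
    have hN : ∀ x, HasDerivAt (fun x => ∫ t in a..x, n t) (n x) x := fun x =>
      (hn.integral_hasStrictDerivAt _ _).hasDerivAt
    have hFd : ∀ x, HasDerivAt (fun x => ∫ t in a..x, F t) (F x) x := fun x =>
      (hF.integral_hasStrictDerivAt _ _).hasDerivAt
    have hH : ∀ x, HasDerivAt
        (fun x => E x * Real.exp (-∫ t in a..x, n t) - ∫ t in a..x, F t)
        ((E' x - n x * E x) * Real.exp (-∫ t in a..x, n t) - F x) x := fun x =>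
      (((hE x).mul (hN x).neg.exp).sub (hFd x)).congr_deriv (by simp only [Pi.neg_apply]; ring)
    have hN0 : ∀ x, a ≤ x → 0 ≤ ∫ t in a..x, n t := fun x hx =>
      intervalIntegral.integral_nonneg hx fun t _ => hn0 t
    have anti := antitoneOn_of_deriv_nonpos (convex_Icc a b)
      (f := fun x => E x * Real.exp (-∫ t in a..x, n t) - ∫ t in a..x, F t)
      (fun x _ => (hH x).continuousAt.continuousWithinAt)
      (fun x _ => (hH x).differentiableAt.differentiableWithinAt)
      (fun x hx => by
        rw [interior_Icc] at hx
        rw [(hH x).deriv]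
        have h1 : E' x - n x * E x ≤ F x := by linarith [h x hx.2.le]
        have h2 : Real.exp (-∫ t in a..x, n t) ≤ 1 :=
          Real.exp_le_one_iff.2 (by linarith [hN0 x hx.1.le])
        nlinarith [Real.exp_pos (-∫ t in a..x, n t), hF0 x])
    have hb := anti (Set.left_mem_Icc.2 hab) (Set.right_mem_Icc.2 hab) hab
    simp only [intervalIntegral.integral_same, neg_zero, Real.exp_zero, mul_one, sub_zero] at hb
    have hFle : ∫ t in a..b, F t ≤ ∫ x in Set.Iic b, F x := by
      rw [intervalIntegral.integral_of_le hab]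
      exact setIntegral_mono_set hFi (Eventually.of_forall hF0)
        (Eventually.of_forall fun x hx => hx.2)
    have hNle : ∫ t in a..b, n t ≤ ∫ x, n x := by
      rw [intervalIntegral.integral_of_le hab]
      exact setIntegral_le_integral hni (Eventually.of_forall hn0)
    have e : Real.exp (∫ t in a..b, n t) * Real.exp (-∫ t in a..b, n t) = 1 := by
      rw [← Real.exp_add]; simp
    have hF0' : 0 ≤ ∫ t in a..b, F t := intervalIntegral.integral_nonneg hab fun t _ => hF0 t
    calc E b = Real.exp (∫ t in a..b, n t) * (E b * Real.exp (-∫ t in a..b, n t)) := by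
          rw [mul_left_comm, e, mul_one]
      _ ≤ Real.exp (∫ t in a..b, n t) * (E a + ∫ t in a..b, F t) := by
          gcongr
          linarith
      _ ≤ _ := by
          gcongr
          have := hE0 a
          positivity
  have lim : Tendsto (fun a => Real.exp (∫ x, n x) * (E a + ∫ x in Set.Iic b, F x)) atBot
      (𝓝 (Real.exp (∫ x, n x) * (0 + ∫ x in Set.Iic b, F x))) :=
    (hlim.add_const _).const_mul _
  rw [zero_add] at lim
  exact ge_of_tendsto lim ((eventually_le_atBot b).mono step)

lemma re_mul_conj_le (a b : ℂ) : (a * conj b).re ≤ ‖a‖ * ‖b‖ :=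
  (Complex.re_le_norm _).trans (by simp)

lemma neg_le_re_mul_conj (a b : ℂ) : -(‖a‖ * ‖b‖) ≤ (a * conj b).re := by
  have := re_mul_conj_le (-a) b
  simp only [neg_mul, Complex.neg_re, norm_neg] at this
  linarith

lemma re_two_I_mul (l z : ℂ) :
    (2 * Complex.I * l ^ 2 * z * conj z).re = -2 * (l ^ 2).im * ‖z‖ ^ 2 := by
  rw [mul_assoc, Complex.mul_conj, Complex.re_mul_ofReal, Complex.normSq_eq_norm_sq]
  simp [mul_assoc]

/-- The energy identity of the inhomogeneous Jost system, as an estimate. -/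
lemma energy_le (u l P Q A B : ℂ) :
    2 * ((l * u * Q + A) * conj P).re +
      2 * ((2 * Complex.I * l ^ 2 * Q - l * conj u * P + B) * conj Q).re ≤
    2 * ‖l‖ * ‖u‖ * (‖P‖ ^ 2 + ‖Q‖ ^ 2) - 4 * (l ^ 2).im * ‖Q‖ ^ 2 +
      2 * ‖A‖ * ‖P‖ + 2 * ‖B‖ * ‖Q‖ := by
  have e1 : ((l * u * Q + A) * conj P).re = (l * u * Q * conj P).re + (A * conj P).re := by
    rw [add_mul, Complex.add_re]
  have e2 : ((2 * Complex.I * l ^ 2 * Q - l * conj u * P + B) * conj Q).re =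
      (2 * Complex.I * l ^ 2 * Q * conj Q).re - (l * conj u * P * conj Q).re
        + (B * conj Q).re := by
    rw [add_mul, sub_mul, Complex.add_re, Complex.sub_re]
  have h1 := re_mul_conj_le (l * u * Q) P
  have h2 := neg_le_re_mul_conj (l * conj u * P) Q
  have h3 := re_mul_conj_le A P
  have h4 := re_mul_conj_le B Q
  simp only [norm_mul, RCLike.norm_conj] at h1 h2
  rw [e1, e2, re_two_I_mul]
  have h5 : ‖l‖ * ‖u‖ * (2 * (‖P‖ * ‖Q‖)) ≤ ‖l‖ * ‖u‖ * (‖P‖ ^ 2 + ‖Q‖ ^ 2) := by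
    gcongr
    nlinarith [sq_nonneg (‖P‖ - ‖Q‖)]
  linarith

section

variable {u : ℝ → ℂ} {l : ℂ} {p q p' q' : ℝ → ℂ}

lemma tendsto_norm_sq_add {f g : ℝ → ℂ} (hf : Tendsto f atBot (𝓝 0))
    (hg : Tendsto g atBot (𝓝 0)) :
    Tendsto (fun x => ‖f x‖ ^ 2 + ‖g x‖ ^ 2) atBot (𝓝 0) := by
  simpa using (hf.norm.pow 2).add (hg.norm.pow 2)

theorem IsMinusPair.unique (hu : Continuous u) (hi : Integrable u) (hl : 0 ≤ (l ^ 2).im)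
    (h : IsMinusPair u l p q) (h' : IsMinusPair u l p' q') : p = p' ∧ q = q' := by
  have hE : ∀ x, HasDerivAt (fun x => ‖p x - p' x‖ ^ 2 + ‖q x - q' x‖ ^ 2) _ x := fun x =>
    (hasDerivAt_norm_sq ((h.deriv_fst x).sub (h'.deriv_fst x))).add
      (hasDerivAt_norm_sq ((h.deriv_snd x).sub (h'.deriv_snd x)))
  have hlim : Tendsto (fun x => ‖p x - p' x‖ ^ 2 + ‖q x - q' x‖ ^ 2) atBot (𝓝 0) :=
    tendsto_norm_sq_add (by simpa using h.tendsto_fst.sub h'.tendsto_fst)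
      (by simpa using h.tendsto_snd.sub h'.tendsto_snd)
  have key : ∀ b, ‖p b - p' b‖ ^ 2 + ‖q b - q' b‖ ^ 2 ≤ 0 := by
    intro b
    have := le_exp_mul_integral_of_deriv_le (b := b) (n := fun x => 2 * ‖l‖ * ‖u x‖)
      (F := fun _ => 0) hE (fun x => by positivity) hlim (by fun_prop)
      (fun x => by positivity) (hi.norm.const_mul _) continuous_const (fun _ => le_rfl)
      (by simp) (fun x _ => by
        have := energy_le (u x) l (p x - p' x) (q x - q' x) 0 0
        simp only [norm_zero, mul_zero, zero_mul, add_zero] at this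
        have e1 : l * u x * q x - l * u x * q' x = l * u x * (q x - q' x) := by ring
        have e2 : 2 * Complex.I * l ^ 2 * q x - l * conj (u x) * p x -
            (2 * Complex.I * l ^ 2 * q' x - l * conj (u x) * p' x) =
            2 * Complex.I * l ^ 2 * (q x - q' x) - l * conj (u x) * (p x - p' x) := by ring
        simp only [Pi.sub_apply, e1, e2]
        have h0 : 0 ≤ 4 * (l ^ 2).im * ‖q x - q' x‖ ^ 2 := by positivity
        linarith)
    simpa using this
  constructor <;> funext b
  · have h1 : ‖p b - p' b‖ ^ 2 = 0 := by
      nlinarith [key b, sq_nonneg ‖p b - p' b‖, sq_nonneg ‖q b - q' b‖]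
    simpa [sub_eq_zero] using h1
  · have h1 : ‖q b - q' b‖ ^ 2 = 0 := by
      nlinarith [key b, sq_nonneg ‖p b - p' b‖, sq_nonneg ‖q b - q' b‖]
    simpa [sub_eq_zero] using h1

/-- A Jost function never vanishes, since a solution vanishing at one point would vanish
everywhere to its left. -/
theorem IsMinusPair.norm_sq_pos (hu : Continuous u) (hl : 0 ≤ (l ^ 2).im)
    (h : IsMinusPair u l p q) (x₀ : ℝ) : 0 < ‖p x₀‖ ^ 2 + ‖q x₀‖ ^ 2 := by
  by_contra hcon
  have h0 : ‖p x₀‖ ^ 2 + ‖q x₀‖ ^ 2 = 0 :=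
    le_antisymm (not_lt.1 hcon) (by positivity)
  set k : ℝ → ℝ := fun x => 4 * (l ^ 2).im + 2 * ‖l‖ * ‖u x‖ with hk
  have hkc : Continuous k := by fun_prop
  have hE : ∀ x, HasDerivAt (fun x => ‖p x‖ ^ 2 + ‖q x‖ ^ 2) _ x := fun x =>
    (hasDerivAt_norm_sq (h.deriv_fst x)).add (hasDerivAt_norm_sq (h.deriv_snd x))
  have hH : ∀ x, HasDerivAt
      (fun x => (‖p x‖ ^ 2 + ‖q x‖ ^ 2) * Real.exp (∫ t in x₀..x, k t)) _ x := fun x =>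
    (hE x).mul ((hkc.integral_hasStrictDerivAt x₀ x).hasDerivAt).exp
  have mono : Monotone (fun x => (‖p x‖ ^ 2 + ‖q x‖ ^ 2) * Real.exp (∫ t in x₀..x, k t)) := by
    refine monotone_of_deriv_nonneg (fun x => (hH x).differentiableAt) fun x => ?_
    have fac : ∀ s t e : ℝ, s * e + t * (e * k x) = (s + t * k x) * e := fun _ _ _ => by ring
    rw [(hH x).deriv, fac]
    refine mul_nonneg ?_ (Real.exp_pos _).le
    have h1 := neg_le_re_mul_conj (l * u x * q x) (p x)
    have h2 := re_mul_conj_le (l * conj (u x) * p x) (q x)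
    simp only [norm_mul, RCLike.norm_conj] at h1 h2
    have h5 : ‖l‖ * ‖u x‖ * (2 * (‖p x‖ * ‖q x‖)) ≤ ‖l‖ * ‖u x‖ * (‖p x‖ ^ 2 + ‖q x‖ ^ 2) := by
      gcongr
      nlinarith [sq_nonneg (‖p x‖ - ‖q x‖)]
    have h6 : 0 ≤ (l ^ 2).im * ‖p x‖ ^ 2 := by positivity
    rw [sub_mul, Complex.sub_re, re_two_I_mul]
    simp only [hk]
    linarith
  have hz : ∀ x ≤ x₀, p x = 0 := by
    intro x hx
    have := mono hx
    simp only [h0, zero_mul] at this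
    have h1 : ‖p x‖ ^ 2 + ‖q x‖ ^ 2 ≤ 0 := nonpos_of_mul_nonpos_left this (Real.exp_pos _)
    have h2 : ‖p x‖ ^ 2 = 0 := by nlinarith [sq_nonneg ‖p x‖, sq_nonneg ‖q x‖]
    simpa using h2
  have : Tendsto p atBot (𝓝 0) :=
    tendsto_const_nhds.congr' ((eventually_le_atBot x₀).mono fun x hx => (hz x hx).symm)
  exact one_ne_zero (tendsto_nhds_unique h.tendsto_fst this)

/-- If `Im l² > 0`, the second component of the Jost function inherits the decay of `u` at `-∞`.
The proof is an energy estimate with the bounded weights `(1 + x²) / (1 + ε x²)`, which are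
nonincreasing on `(-∞, 0]`. -/
theorem IsMinusPair.integrableOn_weight (hu : Continuous u) (hw : MemL21 u)
    (hl : 0 < (l ^ 2).im) (h : IsMinusPair u l p q) :
    IntegrableOn (fun x => (1 + x ^ 2) * ‖q x‖ ^ 2) (Set.Iic 0) := by
  obtain ⟨C, hC⟩ := h.bounded
  have hC0 : 0 ≤ C := (norm_nonneg _).trans (hC 0).1
  set m := (l ^ 2).im with hm
  set κ : ℝ := ‖l‖ ^ 2 * C ^ 2 / (2 * m) with hκ
  have hκ0 : 0 ≤ κ := by positivity
  set I := ∫ x, (1 + x ^ 2) * ‖u x‖ ^ 2 with hI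
  have hqc := h.continuous_snd
  have step : ∀ R : ℝ, 0 < R → ∫ x in (-R)..0, (1 + x ^ 2) * ‖q x‖ ^ 2 ≤ κ * I / m := by
    intro R hR
    set ε : ℝ := 1 / (1 + R ^ 2) with hε
    have hε0 : 0 < ε := by positivity
    have hε1 : ε ≤ 1 := by
      rw [hε, div_le_one (by positivity)]
      nlinarith [sq_nonneg R]
    have hden : ∀ x : ℝ, 0 < 1 + ε * x ^ 2 := fun x => by positivity
    set ρ : ℝ → ℝ := fun x => (1 + x ^ 2) / (1 + ε * x ^ 2) with hρ
    have hρ0 : ∀ x, 0 ≤ ρ x := fun x => by positivity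
    have hρle : ∀ x, ρ x ≤ 1 + x ^ 2 := fun x =>
      div_le_self (by positivity) (by have : 0 ≤ ε * x ^ 2 := by positivity
                                      linarith)
    have hρc : Continuous ρ := by
      refine Continuous.div (by fun_prop) (by fun_prop) fun x => (hden x).ne'
    have hρd : ∀ x, HasDerivAt ρ (2 * x * (1 - ε) / (1 + ε * x ^ 2) ^ 2) x := fun x => by
      have h1 : HasDerivAt (fun x : ℝ => 1 + x ^ 2) (2 * x) x := by
        simpa using (hasDerivAt_pow 2 x).const_add 1
      have h2 : HasDerivAt (fun x : ℝ => 1 + ε * x ^ 2) (ε * (2 * x)) x := by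
        simpa using ((hasDerivAt_pow 2 x).const_mul ε).const_add 1
      refine (h1.div h2 (hden x).ne').congr_deriv ?_
      congr 1
      ring
    set E' : ℝ → ℝ := fun x => 2 * x * (1 - ε) / (1 + ε * x ^ 2) ^ 2 * ‖q x‖ ^ 2 +
      ρ x * (2 * ((2 * Complex.I * l ^ 2 * q x - l * conj (u x) * p x) * conj (q x)).re) with hE'
    have hE : ∀ x, HasDerivAt (fun x => ρ x * ‖q x‖ ^ 2) (E' x) x := fun x =>
      (hρd x).mul (hasDerivAt_norm_sq (h.deriv_snd x))
    have hpc := h.continuous_fst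
    have hE'c : Continuous E' := by
      have c1 : Continuous fun x : ℝ => 2 * x * (1 - ε) / (1 + ε * x ^ 2) ^ 2 :=
        Continuous.div (by fun_prop) (by fun_prop) fun x => (pow_pos (hden x) 2).ne'
      have c2 : Continuous fun x => conj (u x) := Complex.continuous_conj.comp hu
      have c3 : Continuous fun x => conj (q x) := Complex.continuous_conj.comp hqc
      have c4 : Continuous fun x =>
          ((2 * Complex.I * l ^ 2 * q x - l * conj (u x) * p x) * conj (q x)).re :=
        Complex.continuous_re.comp (by fun_prop)
      fun_prop
    have hineq : ∀ x ≤ 0, E' x ≤ -(2 * m) * (ρ x * ‖q x‖ ^ 2) + κ * ((1 + x ^ 2) * ‖u x‖ ^ 2) := by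
      intro x hx
      have h1 : 2 * x * (1 - ε) / (1 + ε * x ^ 2) ^ 2 * ‖q x‖ ^ 2 ≤ 0 := by
        refine mul_nonpos_of_nonpos_of_nonneg
          (div_nonpos_of_nonpos_of_nonneg ?_ (by positivity)) (by positivity)
        nlinarith
      have h2 := neg_le_re_mul_conj (l * conj (u x) * p x) (q x)
      simp only [norm_mul, RCLike.norm_conj] at h2
      have h3 : ‖l‖ * ‖u x‖ * ‖p x‖ * ‖q x‖ ≤ ‖l‖ * ‖u x‖ * C * ‖q x‖ := by
        gcongr
        exact (hC x).1
      -- Young's inequality absorbs half of the damping term.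
      have h4 : 2 * (‖l‖ * ‖u x‖ * C * ‖q x‖) ≤ 2 * m * ‖q x‖ ^ 2 + κ * ‖u x‖ ^ 2 := by
        have e : 2 * m * ‖q x‖ ^ 2 + κ * ‖u x‖ ^ 2 - 2 * (‖l‖ * ‖u x‖ * C * ‖q x‖)
            = (2 * m * ‖q x‖ - ‖l‖ * C * ‖u x‖) ^ 2 / (2 * m) := by
          rw [hκ]
          field_simp
          ring
        have : 0 ≤ (2 * m * ‖q x‖ - ‖l‖ * C * ‖u x‖) ^ 2 / (2 * m) := by positivity
        linarith
      have h5 : 2 * ((2 * Complex.I * l ^ 2 * q x - l * conj (u x) * p x) * conj (q x)).re ≤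
          -(2 * m) * ‖q x‖ ^ 2 + κ * ‖u x‖ ^ 2 := by
        rw [sub_mul, Complex.sub_re, re_two_I_mul, ← hm]
        linarith
      have h6 : ρ x * (κ * ‖u x‖ ^ 2) ≤ (1 + x ^ 2) * (κ * ‖u x‖ ^ 2) := by
        gcongr
        exact hρle x
      have h7 := mul_le_mul_of_nonneg_left h5 (hρ0 x)
      simp only [hE']
      linarith
    have hle : ∀ a ≤ -R, 2 * m * ∫ x in (-R)..0, ρ x * ‖q x‖ ^ 2 ≤ ρ a * ‖q a‖ ^ 2 + κ * I := by
      intro a ha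
      have ha0 : a ≤ 0 := by linarith
      have cE : Continuous fun x => ρ x * ‖q x‖ ^ 2 := by fun_prop
      have cU : Continuous fun x => (1 + x ^ 2) * ‖u x‖ ^ 2 := by fun_prop
      have ftc : ∫ x in a..0, E' x = ρ 0 * ‖q 0‖ ^ 2 - ρ a * ‖q a‖ ^ 2 :=
        intervalIntegral.integral_eq_sub_of_hasDerivAt (fun x _ => hE x)
          (hE'c.intervalIntegrable _ _)
      have b1 : ∫ x in a..0, E' x ≤ ∫ x in a..0,
          (-(2 * m) * (ρ x * ‖q x‖ ^ 2) + κ * ((1 + x ^ 2) * ‖u x‖ ^ 2)) :=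
        intervalIntegral.integral_mono_on ha0 (hE'c.intervalIntegrable _ _)
          (Continuous.intervalIntegrable (by fun_prop) _ _) fun x hx => hineq x hx.2
      have i1 : IntervalIntegrable (fun x => -(2 * m) * (ρ x * ‖q x‖ ^ 2)) volume a 0 :=
        Continuous.intervalIntegrable (by fun_prop) _ _
      have i2 : IntervalIntegrable (fun x => κ * ((1 + x ^ 2) * ‖u x‖ ^ 2)) volume a 0 :=
        Continuous.intervalIntegrable (by fun_prop) _ _
      rw [intervalIntegral.integral_add i1 i2, intervalIntegral.integral_const_mul,
        intervalIntegral.integral_const_mul, ftc] at b1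
      have b2 : ∫ x in a..0, (1 + x ^ 2) * ‖u x‖ ^ 2 ≤ I := by
        rw [intervalIntegral.integral_of_le ha0]
        exact setIntegral_le_integral hw.integrable_weight
          (Eventually.of_forall fun x => by positivity)
      have b3 : ∫ x in (-R)..0, ρ x * ‖q x‖ ^ 2 ≤ ∫ x in a..0, ρ x * ‖q x‖ ^ 2 :=
        intervalIntegral.integral_mono_interval ha (by linarith) le_rfl
          (Eventually.of_forall fun x => mul_nonneg (hρ0 x) (by positivity))
          (cE.intervalIntegrable _ _)
      have b4 : 0 ≤ ρ 0 * ‖q 0‖ ^ 2 := mul_nonneg (hρ0 0) (by positivity)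
      have b5 := mul_le_mul_of_nonneg_left b2 hκ0
      have b6 := mul_le_mul_of_nonneg_left b3 (by positivity : 0 ≤ 2 * m)
      linarith
    have hρε : ∀ x, ρ x ≤ 1 / ε := fun x => by
      rw [hρ, div_le_div_iff₀ (hden x) hε0]
      nlinarith [sq_nonneg x]
    have hlim : Tendsto (fun a => ρ a * ‖q a‖ ^ 2) atBot (𝓝 0) := by
      have h0 : Tendsto (fun a => 1 / ε * ‖q a‖ ^ 2) atBot (𝓝 0) := by
        simpa using (h.tendsto_snd.norm.pow 2).const_mul (1 / ε)
      exact squeeze_zero (fun a => mul_nonneg (hρ0 a) (by positivity))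
        (fun a => mul_le_mul_of_nonneg_right (hρε a) (by positivity)) h0
    have hfin : 2 * m * ∫ x in (-R)..0, ρ x * ‖q x‖ ^ 2 ≤ κ * I := by
      have := ge_of_tendsto (hlim.add_const (κ * I)) ((eventually_le_atBot (-R)).mono hle)
      simpa using this
    have hhalf : ∫ x in (-R)..0, (1 + x ^ 2) * ‖q x‖ ^ 2 ≤
        ∫ x in (-R)..0, 2 * (ρ x * ‖q x‖ ^ 2) := by
      refine intervalIntegral.integral_mono_on (by linarith)
        (Continuous.intervalIntegrable (by fun_prop) _ _)
        (Continuous.intervalIntegrable (by fun_prop) _ _) fun x hx => ?_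
      have hx2 : x ^ 2 ≤ R ^ 2 := sq_le_sq' (by linarith [hx.1]) (by linarith [hx.2])
      have h1 : ε * x ^ 2 ≤ 1 := by
        rw [hε, div_mul_eq_mul_div, div_le_one (by positivity)]
        linarith
      have h2 : 1 + x ^ 2 ≤ 2 * ρ x := by
        rw [hρ, ← mul_div_assoc, le_div_iff₀ (hden x)]
        nlinarith [sq_nonneg x]
      nlinarith [sq_nonneg ‖q x‖]
    rw [intervalIntegral.integral_const_mul] at hhalf
    rw [le_div_iff₀ hl]
    nlinarith
  refine integrableOn_Iic_of_intervalIntegral_norm_bounded (κ * I / m) 0 (l := atTop)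
    (a := fun R : ℝ => -R) (fun R => ?_) tendsto_neg_atTop_atBot ?_
  · exact (Continuous.integrableOn_Ioc (by fun_prop))
  · filter_upwards [eventually_gt_atTop 0] with R hR
    refine (intervalIntegral.integral_congr fun x _ => ?_).trans_le (step R hR)
    exact Real.norm_of_nonneg (by positivity)

/-- Continuity in the spectral parameter of the Jost function at a fixed point, in the open region
`Im l² > 0`. -/
theorem tendsto_isMinusPair (hu : Continuous u) (hw : MemL21 u) {P Q : ℂ → ℝ → ℂ}
    (hPQ : ∀ l : ℂ, 0 ≤ (l ^ 2).im → IsMinusPair u l (P l) (Q l)) {l₀ : ℂ}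
    (hl₀ : 0 < (l₀ ^ 2).im) :
    Tendsto (fun l => P l 0) (𝓝 l₀) (𝓝 (P l₀ 0)) ∧
      Tendsto (fun l => Q l 0) (𝓝 l₀) (𝓝 (Q l₀ 0)) := by
  have hi := hw.integrable
  have h₀ := hPQ l₀ hl₀.le
  obtain ⟨C, hC⟩ := h₀.bounded
  have hC0 : 0 ≤ C := (norm_nonneg _).trans (hC 0).1
  set m := (l₀ ^ 2).im with hm
  set K : ℝ := 2 * (‖l₀‖ + 1) + 1 with hK
  have hdecay := h₀.integrableOn_weight hu hw hl₀
  have hpc := h₀.continuous_fst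
  have hqc := h₀.continuous_snd
  have hq2 : IntegrableOn (fun x => ‖Q l₀ x‖ ^ 2) (Set.Iic 0) := by
    refine Integrable.mono' hdecay (Continuous.aestronglyMeasurable (by fun_prop))
      (Eventually.of_forall fun x => ?_)
    rw [Real.norm_of_nonneg (by positivity)]
    nlinarith [sq_nonneg x, sq_nonneg ‖Q l₀ x‖, mul_nonneg (sq_nonneg x) (sq_nonneg ‖Q l₀ x‖)]
  set I₁ := ∫ x in Set.Iic (0 : ℝ), ‖u x‖
  set I₂ := ∫ x in Set.Iic (0 : ℝ), ‖Q l₀ x‖ ^ 2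
  set bound : ℂ → ℝ := fun l => Real.exp (∫ x, K * ‖u x‖) *
    (2 * ‖l - l₀‖ * C ^ 2 * I₁ + 2 * ‖l ^ 2 - l₀ ^ 2‖ ^ 2 / m * I₂) with hbound
  have main : ∀ᶠ l in 𝓝 l₀, ‖P l 0 - P l₀ 0‖ ^ 2 + ‖Q l 0 - Q l₀ 0‖ ^ 2 ≤ bound l := by
    have n1 : ∀ᶠ l in 𝓝 l₀, m / 2 < (l ^ 2).im := by
      have hc : Continuous fun l : ℂ => (l ^ 2).im := Complex.continuous_im.comp (by fun_prop)
      exact hc.continuousAt.eventually_const_lt (by linarith)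
    have n2 : ∀ᶠ l in 𝓝 l₀, ‖l - l₀‖ < 1 := by
      have hc : Continuous fun l : ℂ => ‖l - l₀‖ := by fun_prop
      exact hc.continuousAt.eventually_lt_const (by simp)
    filter_upwards [n1, n2] with l hlm hl1
    have hlpos : 0 < (l ^ 2).im := by linarith
    have h := hPQ l hlpos.le
    set δ := ‖l - l₀‖ with hδ
    have hδ0 : 0 ≤ δ := norm_nonneg _
    set η := ‖l ^ 2 - l₀ ^ 2‖ with hη
    have hη0 : 0 ≤ η := norm_nonneg _
    have hll : ‖l‖ ≤ ‖l₀‖ + 1 := by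
      have := norm_sub_norm_le l l₀
      linarith
    have hE : ∀ x, HasDerivAt (fun x => ‖P l x - P l₀ x‖ ^ 2 + ‖Q l x - Q l₀ x‖ ^ 2) _ x :=
      fun x => (hasDerivAt_norm_sq ((h.deriv_fst x).sub (h₀.deriv_fst x))).add
        (hasDerivAt_norm_sq ((h.deriv_snd x).sub (h₀.deriv_snd x)))
    have hlim : Tendsto (fun x => ‖P l x - P l₀ x‖ ^ 2 + ‖Q l x - Q l₀ x‖ ^ 2) atBot (𝓝 0) :=
      tendsto_norm_sq_add (by simpa using h.tendsto_fst.sub h₀.tendsto_fst)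
        (by simpa using h.tendsto_snd.sub h₀.tendsto_snd)
    have i1 : IntegrableOn (fun x => 2 * δ * C ^ 2 * ‖u x‖) (Set.Iic 0) :=
      (hi.norm.const_mul _).integrableOn
    have i2 : IntegrableOn (fun x => 2 * η ^ 2 / m * ‖Q l₀ x‖ ^ 2) (Set.Iic 0) :=
      Integrable.const_mul hq2 _
    have res := le_exp_mul_integral_of_deriv_le (b := 0) (n := fun x => K * ‖u x‖)
      (F := fun x => 2 * δ * C ^ 2 * ‖u x‖ + 2 * η ^ 2 / m * ‖Q l₀ x‖ ^ 2) hE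
      (fun x => by positivity) hlim (by fun_prop) (fun x => by positivity)
      (hi.norm.const_mul _) (by fun_prop) (fun x => by positivity) (i1.add i2) (fun x _ => by
        set p := P l x - P l₀ x
        set q := Q l x - Q l₀ x
        have en := energy_le (u x) l p q ((l - l₀) * u x * Q l₀ x)
          (2 * Complex.I * (l ^ 2 - l₀ ^ 2) * Q l₀ x - (l - l₀) * conj (u x) * P l₀ x)
        have e1 : l * u x * Q l x - l₀ * u x * Q l₀ x =
            l * u x * q + (l - l₀) * u x * Q l₀ x := by ring
        have e2 : 2 * Complex.I * l ^ 2 * Q l x - l * conj (u x) * P l x -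
            (2 * Complex.I * l₀ ^ 2 * Q l₀ x - l₀ * conj (u x) * P l₀ x) =
            2 * Complex.I * l ^ 2 * q - l * conj (u x) * p +
            (2 * Complex.I * (l ^ 2 - l₀ ^ 2) * Q l₀ x - (l - l₀) * conj (u x) * P l₀ x) := by
          ring
        simp only [Pi.sub_apply, e1, e2]
        refine en.trans ?_
        have a1 : ‖(l - l₀) * u x * Q l₀ x‖ ≤ δ * ‖u x‖ * C := by
          rw [norm_mul, norm_mul]
          gcongr
          exact (hC x).2
        have a2 : ‖2 * Complex.I * (l ^ 2 - l₀ ^ 2) * Q l₀ x - (l - l₀) * conj (u x) * P l₀ x‖ ≤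
            2 * η * ‖Q l₀ x‖ + δ * ‖u x‖ * C := by
          refine (norm_sub_le _ _).trans (add_le_add (by simp [hη]) ?_)
          rw [norm_mul, norm_mul, RCLike.norm_conj]
          gcongr
          exact (hC x).1
        have b1 : 2 * ‖(l - l₀) * u x * Q l₀ x‖ * ‖p‖ ≤ δ * ‖u x‖ * (C ^ 2 + ‖p‖ ^ 2) :=
          calc _ ≤ 2 * (δ * ‖u x‖ * C) * ‖p‖ := by gcongr
            _ = δ * ‖u x‖ * (2 * C * ‖p‖) := by ring
            _ ≤ _ := by
              gcongr
              nlinarith [sq_nonneg (C - ‖p‖)]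
        have b2 : 2 * (δ * ‖u x‖ * C) * ‖q‖ ≤ δ * ‖u x‖ * (C ^ 2 + ‖q‖ ^ 2) :=
          calc _ = δ * ‖u x‖ * (2 * C * ‖q‖) := by ring
            _ ≤ _ := by
              gcongr
              nlinarith [sq_nonneg (C - ‖q‖)]
        -- Young's inequality absorbs this term into the damping `-4 Im l² ‖q‖²`.
        have b3 : 2 * (2 * η * ‖Q l₀ x‖) * ‖q‖ ≤
            2 * m * ‖q‖ ^ 2 + 2 * η ^ 2 / m * ‖Q l₀ x‖ ^ 2 := by
          have e : 2 * m * ‖q‖ ^ 2 + 2 * η ^ 2 / m * ‖Q l₀ x‖ ^ 2 - 2 * (2 * η * ‖Q l₀ x‖) * ‖q‖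
              = 2 * (m * ‖q‖ - η * ‖Q l₀ x‖) ^ 2 / m := by
            field_simp
            ring
          have : 0 ≤ 2 * (m * ‖q‖ - η * ‖Q l₀ x‖) ^ 2 / m := by positivity
          linarith
        have b4 : 2 * ‖2 * Complex.I * (l ^ 2 - l₀ ^ 2) * Q l₀ x -
            (l - l₀) * conj (u x) * P l₀ x‖ * ‖q‖ ≤
            2 * (2 * η * ‖Q l₀ x‖ + δ * ‖u x‖ * C) * ‖q‖ := by gcongr
        have b5 : 2 * m * ‖q‖ ^ 2 ≤ 4 * (l ^ 2).im * ‖q‖ ^ 2 :=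
          mul_le_mul_of_nonneg_right (by linarith) (sq_nonneg _)
        have b6 : (2 * ‖l‖ + δ) * ‖u x‖ * (‖p‖ ^ 2 + ‖q‖ ^ 2) ≤
            K * ‖u x‖ * (‖p‖ ^ 2 + ‖q‖ ^ 2) := by
          gcongr
          rw [hK]
          linarith
        linarith)
    refine res.trans (le_of_eq ?_)
    rw [integral_add i1 i2, integral_const_mul (2 * δ * C ^ 2), integral_const_mul (2 * η ^ 2 / m)]
  have hb0 : Tendsto bound (𝓝 l₀) (𝓝 0) := by
    have hc : Continuous bound := by fun_prop
    have := hc.tendsto l₀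
    have e : bound l₀ = 0 := by simp [hbound]
    rwa [e] at this
  have lim2 : ∀ f g : ℂ → ℂ, (∀ᶠ l in 𝓝 l₀, ‖f l - f l₀‖ ^ 2 + ‖g l - g l₀‖ ^ 2 ≤ bound l) →
      Tendsto f (𝓝 l₀) (𝓝 (f l₀)) := by
    intro f g hfg
    rw [tendsto_iff_norm_sub_tendsto_zero]
    have hs : Tendsto (fun l => Real.sqrt (bound l)) (𝓝 l₀) (𝓝 0) := by
      simpa using hb0.sqrt
    refine squeeze_zero' (Eventually.of_forall fun l => norm_nonneg _) (hfg.mono fun l hl => ?_) hs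
    refine Real.le_sqrt_of_sq_le ?_
    linarith [sq_nonneg ‖g l - g l₀‖]
  refine ⟨lim2 (fun l => P l 0) (fun l => Q l 0) main, lim2 (fun l => Q l 0) (fun l => P l 0) ?_⟩
  filter_upwards [main] with l hl
  linarith

end

/-! ### Jost functions and the scattering coefficient for continuous potentials -/

lemma isSolution_iff {u : ℝ → ℂ} (hu : Continuous u) (l : ℂ) (ψ : ℝ → Fin 2 → ℂ) :
    IsSolution u l ψ ↔
      (∀ x, HasDerivAt (fun x => ψ x 0) (-Complex.I * l ^ 2 * ψ x 0 + l * u x * ψ x 1) x) ∧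
      ∀ x, HasDerivAt (fun x => ψ x 1) (Complex.I * l ^ 2 * ψ x 1 - l * conj (u x) * ψ x 0) x := by
  have hconj : Continuous fun x => conj (u x) := Complex.continuous_conj.comp hu
  have hcont : Continuous ψ → Continuous fun t => (coeff u l t).mulVec (ψ t) := by
    intro hψ
    have h0 : Continuous fun x => ψ x 0 := (continuous_apply 0).comp hψ
    have h1 : Continuous fun x => ψ x 1 := (continuous_apply 1).comp hψ
    simp only [coeff_mulVec]
    refine continuous_pi fun i => ?_
    fin_cases i
    · simp only [Fin.zero_eta, Matrix.cons_val_zero]; fun_prop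
    · simp only [Fin.mk_one, Matrix.cons_val_one, Matrix.cons_val_fin_one]; fun_prop
  have hiff : (∀ x, HasDerivAt ψ ((coeff u l x).mulVec (ψ x)) x) ↔
      (∀ x, HasDerivAt (fun x => ψ x 0) (-Complex.I * l ^ 2 * ψ x 0 + l * u x * ψ x 1) x) ∧
      ∀ x, HasDerivAt (fun x => ψ x 1)
        (Complex.I * l ^ 2 * ψ x 1 - l * conj (u x) * ψ x 0) x := by
    rw [← forall_and]
    refine forall_congr' fun x => ?_
    rw [hasDerivAt_pi, Fin.forall_fin_two, coeff_mulVec]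
    simp
  rw [← hiff]
  constructor
  · rintro ⟨hψ, h⟩ x
    have e : ψ = fun x => ψ 0 + ∫ t in (0 : ℝ)..x, (coeff u l t).mulVec (ψ t) := by
      funext y
      rw [← (h 0 y).2]
      abel
    have hd := (((hcont hψ).integral_hasStrictDerivAt 0 x).hasDerivAt).const_add (ψ 0)
    rwa [← e] at hd
  · intro h
    have hψ : Continuous ψ := continuous_iff_continuousAt.2 fun x => (h x).continuousAt
    exact ⟨hψ, fun x y => ⟨(hcont hψ).intervalIntegrable _ _,
      (intervalIntegral.integral_eq_sub_of_hasDerivAt (fun t _ => h t)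
        ((hcont hψ).intervalIntegrable _ _)).symm⟩⟩

lemma hasDerivAt_cexp_mul (c : ℂ) (x : ℝ) :
    HasDerivAt (fun x : ℝ => Complex.exp (c * x)) (c * Complex.exp (c * x)) x := by
  have := ((Complex.ofRealCLM.hasDerivAt (x := x)).const_mul c).cexp
  simpa [mul_comm] using this

lemma hasDerivAt_cexp_mul_iff {c : ℂ} {g : ℝ → ℂ} {g' : ℂ} {x : ℝ} :
    HasDerivAt (fun x : ℝ => Complex.exp (c * x) * g x)
      (Complex.exp (c * x) * (c * g x + g')) x ↔ HasDerivAt g g' x := by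
  constructor
  · intro h
    have e : ∀ y : ℝ, Complex.exp (-c * y) * Complex.exp (c * y) = 1 := fun y => by
      rw [← Complex.exp_add]; simp
    have h2 := (hasDerivAt_cexp_mul (-c) x).mul h
    have e2 : ((fun x : ℝ => Complex.exp (-c * x)) * fun x : ℝ => Complex.exp (c * x) * g x)
        = g := by
      funext y
      simp only [Pi.mul_apply]
      rw [← mul_assoc, e, one_mul]
    rw [e2] at h2
    exact h2.congr_deriv (by linear_combination g' * e x)
  · intro h
    exact ((hasDerivAt_cexp_mul c x).mul h).congr_deriv (by ring)

lemma isBounded_fin_two_iff {f : ℝ → Fin 2 → ℂ} :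
    (∃ C : ℝ, ∀ x, ‖f x‖ ≤ C) ↔ ∃ C : ℝ, ∀ x, ‖f x 0‖ ≤ C ∧ ‖f x 1‖ ≤ C := by
  constructor
  · rintro ⟨C, hC⟩
    exact ⟨C, fun x => ⟨(norm_le_pi_norm _ _).trans (hC x), (norm_le_pi_norm _ _).trans (hC x)⟩⟩
  · rintro ⟨C, hC⟩
    refine ⟨C, fun x => (pi_norm_le_iff_of_nonneg ((norm_nonneg _).trans (hC x).1)).2 ?_⟩
    rw [Fin.forall_fin_two]
    exact hC x

lemma isJostMinus_iff {u : ℝ → ℂ} (hu : Continuous u) (l : ℂ) (f : ℝ → Fin 2 → ℂ) :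
    IsJostMinus u l f ↔ IsMinusPair u l (fun x => f x 0) (fun x => f x 1) := by
  have h1 : ∀ x : ℝ, HasDerivAt
      (fun x : ℝ => (Complex.exp (-Complex.I * l ^ 2 * x) • f x) 0)
      (-Complex.I * l ^ 2 * (Complex.exp (-Complex.I * l ^ 2 * x) • f x) 0 +
        l * u x * (Complex.exp (-Complex.I * l ^ 2 * x) • f x) 1) x ↔
      HasDerivAt (fun x => f x 0) (l * u x * f x 1) x := fun x => by
    rw [← hasDerivAt_cexp_mul_iff (c := -Complex.I * l ^ 2) (g := fun x => f x 0)]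
    simp only [Pi.smul_apply, smul_eq_mul]
    ring_nf
  have h2 : ∀ x : ℝ, HasDerivAt
      (fun x : ℝ => (Complex.exp (-Complex.I * l ^ 2 * x) • f x) 1)
      (Complex.I * l ^ 2 * (Complex.exp (-Complex.I * l ^ 2 * x) • f x) 1 -
        l * conj (u x) * (Complex.exp (-Complex.I * l ^ 2 * x) • f x) 0) x ↔
      HasDerivAt (fun x => f x 1)
        (2 * Complex.I * l ^ 2 * f x 1 - l * conj (u x) * f x 0) x := fun x => by
    rw [← hasDerivAt_cexp_mul_iff (c := -Complex.I * l ^ 2) (g := fun x => f x 1)]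
    simp only [Pi.smul_apply, smul_eq_mul]
    ring_nf
  rw [IsJostMinus, isBounded_fin_two_iff, isSolution_iff hu, tendsto_pi_nhds, Fin.forall_fin_two]
  simp only [h1, h2, Matrix.cons_val_zero, Matrix.cons_val_one, Matrix.cons_val_fin_one]
  exact ⟨fun ⟨hb, ⟨t0, t1⟩, d0, d1⟩ => ⟨d0, d1, hb, t0, t1⟩,
    fun h => ⟨h.bounded, ⟨h.tendsto_fst, h.tendsto_snd⟩, h.deriv_fst, h.deriv_snd⟩⟩

/-- The reflection `x ↦ conj (u (-x))`. Exchanging the two components and reflecting `x` turns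
solutions for `u` into solutions for the reflection of `u`, with the same spectral parameter, and
exchanges the two ends of the line. -/
def reflect (u : ℝ → ℂ) (x : ℝ) : ℂ := conj (u (-x))

lemma continuous_reflect {u : ℝ → ℂ} (hu : Continuous u) : Continuous (reflect u) :=
  Complex.continuous_conj.comp (hu.comp continuous_neg)

lemma hasDerivAt_comp_neg {f : ℝ → ℂ} {f' : ℂ} {x : ℝ} (h : HasDerivAt f f' (-x)) :
    HasDerivAt (fun x => f (-x)) (-f') x := by
  have := h.scomp x (hasDerivAt_neg x)
  simpa [Function.comp_def] using this

lemma hasDerivAt_comp_neg_iff {f : ℝ → ℂ} {f' : ℝ → ℂ} :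
    (∀ x, HasDerivAt (fun x => f (-x)) (-f' (-x)) x) ↔ ∀ x, HasDerivAt f (f' x) x := by
  constructor
  · intro h x
    have := hasDerivAt_comp_neg (h (-x))
    simpa using this
  · intro h x
    exact hasDerivAt_comp_neg (h (-x))

lemma isJostPlus_iff {u : ℝ → ℂ} (hu : Continuous u) (l : ℂ) (f : ℝ → Fin 2 → ℂ) :
    IsJostPlus u l f ↔
      IsMinusPair (reflect u) l (fun x => f (-x) 1) (fun x => f (-x) 0) := by
  have h1 : ∀ x : ℝ, HasDerivAt
      (fun x : ℝ => (Complex.exp (Complex.I * l ^ 2 * x) • f x) 0)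
      (-Complex.I * l ^ 2 * (Complex.exp (Complex.I * l ^ 2 * x) • f x) 0 +
        l * u x * (Complex.exp (Complex.I * l ^ 2 * x) • f x) 1) x ↔
      HasDerivAt (fun x => f x 0) (-2 * Complex.I * l ^ 2 * f x 0 + l * u x * f x 1) x :=
    fun x => by
    rw [← hasDerivAt_cexp_mul_iff (c := Complex.I * l ^ 2) (g := fun x => f x 0)]
    simp only [Pi.smul_apply, smul_eq_mul]
    ring_nf
  have h2 : ∀ x : ℝ, HasDerivAt
      (fun x : ℝ => (Complex.exp (Complex.I * l ^ 2 * x) • f x) 1)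
      (Complex.I * l ^ 2 * (Complex.exp (Complex.I * l ^ 2 * x) • f x) 1 -
        l * conj (u x) * (Complex.exp (Complex.I * l ^ 2 * x) • f x) 0) x ↔
      HasDerivAt (fun x => f x 1) (-(l * conj (u x) * f x 0)) x := fun x => by
    rw [← hasDerivAt_cexp_mul_iff (c := Complex.I * l ^ 2) (g := fun x => f x 1)]
    simp only [Pi.smul_apply, smul_eq_mul]
    ring_nf
  have d0 : (∀ x, HasDerivAt (fun x => f x 0) (-2 * Complex.I * l ^ 2 * f x 0 + l * u x * f x 1) x)
      ↔ ∀ x, HasDerivAt (fun x => f (-x) 0)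
        (2 * Complex.I * l ^ 2 * f (-x) 0 - l * conj (reflect u x) * f (-x) 1) x := by
    rw [← hasDerivAt_comp_neg_iff]
    refine forall_congr' fun x => ?_
    simp only [reflect, Complex.conj_conj]
    ring_nf
  have d1 : (∀ x, HasDerivAt (fun x => f x 1) (-(l * conj (u x) * f x 0)) x)
      ↔ ∀ x, HasDerivAt (fun x => f (-x) 1) (l * reflect u x * f (-x) 0) x := by
    rw [← hasDerivAt_comp_neg_iff]
    refine forall_congr' fun x => ?_
    simp only [reflect, neg_neg]
  have t : ∀ (g : ℝ → ℂ) (z : ℂ),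
      Tendsto g atTop (𝓝 z) ↔ Tendsto (fun x => g (-x)) atBot (𝓝 z) := fun g z =>
    ⟨fun h => h.comp tendsto_neg_atBot_atTop, fun h => by
      simpa [Function.comp_def] using h.comp tendsto_neg_atTop_atBot⟩
  rw [IsJostPlus, isBounded_fin_two_iff, isSolution_iff hu, tendsto_pi_nhds, Fin.forall_fin_two]
  simp only [h1, h2, Matrix.cons_val_zero, Matrix.cons_val_one, Matrix.cons_val_fin_one]
  rw [d0, d1, t, t]
  constructor
  · rintro ⟨⟨C, hC⟩, ⟨t0, t1⟩, d0, d1⟩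
    exact ⟨d1, d0, ⟨C, fun x => (hC (-x)).symm⟩, t1, t0⟩
  · intro h
    obtain ⟨C, hC⟩ := h.bounded
    exact ⟨⟨C, fun x => by simpa using (hC (-x)).symm⟩, ⟨h.tendsto_snd, h.tendsto_fst⟩,
      h.deriv_snd, h.deriv_fst⟩

section

variable {u : ℝ → ℂ} {l : ℂ}

lemma integrable_reflect (hi : Integrable u) : Integrable (reflect u) := by
  have : Integrable fun x => u (-x) := hi.comp_neg
  refine this.mono (Complex.continuous_conj.comp_aestronglyMeasurable this.1)
    (Eventually.of_forall fun x => (RCLike.norm_conj _).le)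

lemma jostMinus_spec (hu : Continuous u) (hi : Integrable u) (hl : 0 ≤ (l ^ 2).im) :
    IsMinusPair u l (fun x => jostMinus u l x 0) (fun x => jostMinus u l x 1) := by
  have h : ∃ f, IsJostMinus u l f := by
    obtain ⟨p, q, hpq⟩ := exists_isMinusPair hu hi hl
    exact ⟨fun x => ![p x, q x], (isJostMinus_iff hu l _).2 (by simpa using hpq)⟩
  have := h.choose_spec
  rw [← isJostMinus_iff hu, jostMinus, dif_pos h]
  exact this

lemma jostPlus_spec (hu : Continuous u) (hi : Integrable u) (hl : 0 ≤ (l ^ 2).im) :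
    IsMinusPair (reflect u) l (fun x => jostPlus u l (-x) 1) (fun x => jostPlus u l (-x) 0) := by
  have h : ∃ f, IsJostPlus u l f := by
    obtain ⟨p, q, hpq⟩ := exists_isMinusPair (continuous_reflect hu) (integrable_reflect hi) hl
    exact ⟨fun x => ![q (-x), p (-x)], (isJostPlus_iff hu l _).2 (by simpa using hpq)⟩
  have := h.choose_spec
  rw [← isJostPlus_iff hu, jostPlus, dif_pos h]
  exact this

lemma scatA_eq (u : ℝ → ℂ) (l : ℂ) : scatA u l =
    jostMinus u l 0 0 * jostPlus u l 0 1 - jostPlus u l 0 0 * jostMinus u l 0 1 := by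
  simp [scatA, wronskian, minusSolution, plusSolution]

/-- The scattering coefficient in terms of the Jost problems for `u` and its reflection. -/
lemma scatA_eq_of_isMinusPair (hu : Continuous u) (hi : Integrable u) (hl : 0 ≤ (l ^ 2).im)
    {p q P Q : ℝ → ℂ} (h : IsMinusPair u l p q) (H : IsMinusPair (reflect u) l P Q) :
    scatA u l = p 0 * P 0 - Q 0 * q 0 := by
  obtain ⟨e1, e2⟩ := (jostMinus_spec hu hi hl).unique hu hi hl h
  obtain ⟨e3, e4⟩ := (jostPlus_spec hu hi hl).unique (continuous_reflect hu)
    (integrable_reflect hi) hl H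
  rw [scatA_eq, ← e1, ← e2, ← e3, ← e4]
  simp

lemma continuousAt_scatA (hu : Continuous u) (hw : MemL21 u) (hl : 0 < (l ^ 2).im) :
    ContinuousAt (scatA u) l := by
  have hi := hw.integrable
  obtain ⟨t1, t2⟩ := tendsto_isMinusPair hu hw (P := fun l x => jostMinus u l x 0)
    (Q := fun l x => jostMinus u l x 1) (fun l hl => jostMinus_spec hu hi hl) hl
  obtain ⟨t3, t4⟩ := tendsto_isMinusPair (continuous_reflect hu) hw.comp_neg
    (P := fun l x => jostPlus u l (-x) 1) (Q := fun l x => jostPlus u l (-x) 0)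
    (fun l hl => jostPlus_spec hu hi hl) hl
  simp only [neg_zero] at t3 t4
  have := (t1.mul t3).sub (t4.mul t2)
  rw [ContinuousAt, scatA_eq]
  exact this.congr fun l => (scatA_eq u l).symm

/-- The Wronskian of the two Jost solutions does not depend on `x`. -/
lemma scatA_eq_wronskian (hu : Continuous u) (hi : Integrable u) (hl : 0 ≤ (l ^ 2).im)
    {p q P Q : ℝ → ℂ} (h : IsMinusPair u l p q) (H : IsMinusPair (reflect u) l P Q) (x : ℝ) :
    scatA u l = p x * P (-x) - Q (-x) * q x := by
  have hd : ∀ x, HasDerivAt (fun x => p x * P (-x) - Q (-x) * q x) 0 x := fun x => by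
    have h1 := ((h.deriv_fst x).mul (hasDerivAt_comp_neg (H.deriv_fst (-x)))).sub
      ((hasDerivAt_comp_neg (H.deriv_snd (-x))).mul (h.deriv_snd x))
    refine h1.congr_deriv ?_
    simp only [reflect, neg_neg, Complex.conj_conj]
    ring
  have hc := is_const_of_deriv_eq_zero (fun x => (hd x).differentiableAt)
    (fun x => (hd x).deriv) 0 x
  rw [scatA_eq_of_isMinusPair hu hi hl h H, ← hc]
  simp

end

/-! ### The Darboux matrix -/

/-- The data of the Darboux transformation from `u` to `u₁` with spectral parameter `l₁`. With
`N = |l₁|²`, the matrix `T(l) = [[l² G - N, l b], [l b̄, N - l² Ḡ]]` maps solutions of the spectral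
problem for `u` to solutions for `u₁`. -/
structure IsDarboux (l₁ : ℂ) (u u₁ G b : ℝ → ℂ) : Prop where
  mul_conj : ∀ x, G x * conj (G x) = 1
  trace : ∀ x, l₁ * conj l₁ * (G x + conj (G x)) - b x * conj (b x) = l₁ ^ 2 + conj l₁ ^ 2
  eq : ∀ x, u₁ x = -G x ^ 2 * u x - 2 * Complex.I * G x * b x
  deriv_G : ∀ x, HasDerivAt G (u₁ x * conj (b x) + b x * conj (u x)) x
  deriv_b : ∀ x, HasDerivAt b (l₁ * conj l₁ * (u₁ x + u x)) x
  bounded : ∃ C : ℝ, ∀ x, ‖b x‖ ≤ C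
  tendsto_G_atBot : Tendsto G atBot (𝓝 (conj l₁ / l₁))
  tendsto_G_atTop : Tendsto G atTop (𝓝 (l₁ / conj l₁))
  tendsto_b_atBot : Tendsto b atBot (𝓝 0)
  tendsto_b_atTop : Tendsto b atTop (𝓝 0)

lemma hasDerivAt_conj {f : ℝ → ℂ} {f' : ℂ} {x : ℝ} (h : HasDerivAt f f' x) :
    HasDerivAt (fun x => conj (f x)) (conj f') x := h.star

section

variable {l₁ : ℂ} {u u₁ G b : ℝ → ℂ}

lemma IsDarboux.norm_G (h : IsDarboux l₁ u u₁ G b) (x : ℝ) : ‖G x‖ = 1 := by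
  have h1 := h.mul_conj x
  rw [Complex.mul_conj, Complex.normSq_eq_norm_sq] at h1
  have h2 : ‖G x‖ ^ 2 = 1 := by exact_mod_cast h1
  nlinarith [norm_nonneg (G x)]

lemma tendsto_reflect_atBot {f : ℝ → ℂ} {z : ℂ} (h : Tendsto f atTop (𝓝 z)) :
    Tendsto (reflect f) atBot (𝓝 (conj z)) :=
  ((Complex.continuous_conj.tendsto z).comp h).comp tendsto_neg_atBot_atTop

lemma tendsto_reflect_atTop {f : ℝ → ℂ} {z : ℂ} (h : Tendsto f atBot (𝓝 z)) :
    Tendsto (reflect f) atTop (𝓝 (conj z)) :=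
  ((Complex.continuous_conj.tendsto z).comp h).comp tendsto_neg_atTop_atBot

lemma IsDarboux.reflect (h : IsDarboux l₁ u u₁ G b) :
    IsDarboux l₁ (reflect u) (reflect u₁) (reflect G) (fun x => -reflect b x) := by
  refine ⟨fun x => ?_, fun x => ?_, fun x => ?_, fun x => ?_, fun x => ?_, ?_, ?_, ?_, ?_, ?_⟩
  · have := h.mul_conj (-x)
    simp only [KN.reflect, Complex.conj_conj]
    linear_combination this
  · have := h.trace (-x)
    simp only [KN.reflect, Complex.conj_conj, map_neg]
    linear_combination this
  · have := congrArg conj (h.eq (-x))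
    simp only [map_sub, map_mul, map_neg, map_pow, map_ofNat, Complex.conj_I] at this
    simp only [KN.reflect, this]
    ring
  · refine (hasDerivAt_comp_neg (hasDerivAt_conj (h.deriv_G (-x)))).congr_deriv ?_
    simp only [KN.reflect, map_add, map_mul, map_neg, Complex.conj_conj]
    ring
  · refine (hasDerivAt_comp_neg (hasDerivAt_conj (h.deriv_b (-x)))).neg.congr_deriv ?_
    simp only [KN.reflect, map_add, map_mul, Complex.conj_conj]
    ring
  · obtain ⟨C, hC⟩ := h.bounded
    exact ⟨C, fun x => by simpa [KN.reflect] using hC (-x)⟩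
  · simpa using tendsto_reflect_atBot h.tendsto_G_atTop
  · simpa using tendsto_reflect_atTop h.tendsto_G_atBot
  · simpa using (tendsto_reflect_atBot h.tendsto_b_atTop).neg
  · simpa using (tendsto_reflect_atTop h.tendsto_b_atBot).neg

/-- The normalized Darboux matrix maps the Jost function `φ₋` for `u` to that for `u₁`. -/
theorem IsDarboux.isMinusPair (h : IsDarboux l₁ u u₁ G b) (h₁ : l₁ ≠ 0) {l : ℂ}
    (hne : l ^ 2 ≠ l₁ ^ 2) {p q : ℝ → ℂ} (hpq : IsMinusPair u l p q) :
    IsMinusPair u₁ l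
      (fun x => l₁ / (conj l₁ * (l ^ 2 - l₁ ^ 2)) *
        ((l ^ 2 * G x - l₁ * conj l₁) * p x + l * b x * q x))
      (fun x => l₁ / (conj l₁ * (l ^ 2 - l₁ ^ 2)) *
        (l * conj (b x) * p x + (l₁ * conj l₁ - l ^ 2 * conj (G x)) * q x)) := by
  set c := l₁ / (conj l₁ * (l ^ 2 - l₁ ^ 2)) with hc
  have hc₁ : conj l₁ ≠ 0 := by simpa using h₁
  have hsub : l ^ 2 - l₁ ^ 2 ≠ 0 := sub_ne_zero.2 hne
  have rel : ∀ x, G x * u x + 2 * Complex.I * b x + conj (G x) * u₁ x = 0 := fun x => by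
    rw [h.eq]
    linear_combination (-(G x * u x) - 2 * Complex.I * b x) * h.mul_conj x
  have rel' : ∀ x, conj (G x) * conj (u x) - 2 * Complex.I * conj (b x) + G x * conj (u₁ x) = 0 :=
    fun x => by
    have := congrArg conj (rel x)
    simp only [map_add, map_mul, map_ofNat, Complex.conj_I, Complex.conj_conj, map_zero] at this
    linear_combination this
  refine ⟨fun x => ?_, fun x => ?_, ?_, ?_, ?_⟩
  · refine ((((((h.deriv_G x).const_mul (l ^ 2)).sub_const (l₁ * conj l₁)).mul
      (hpq.deriv_fst x)).add (((h.deriv_b x).const_mul l).mul (hpq.deriv_snd x))).const_mul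
      c).congr_deriv ?_
    linear_combination (c * l ^ 3 * q x) * rel x
  · refine (((((hasDerivAt_conj (h.deriv_b x)).const_mul l).mul (hpq.deriv_fst x)).add
      ((((hasDerivAt_conj (h.deriv_G x)).const_mul (l ^ 2)).const_sub (l₁ * conj l₁)).mul
      (hpq.deriv_snd x))).const_mul c).congr_deriv ?_
    simp only [map_add, map_mul, Complex.conj_conj]
    linear_combination (c * l ^ 3 * p x) * rel' x
  · obtain ⟨C, hC⟩ := hpq.bounded
    obtain ⟨D, hD⟩ := h.bounded
    have hD0 : 0 ≤ D := (norm_nonneg _).trans (hD 0)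
    set M := ‖c‖ * ((‖l‖ ^ 2 * 1 + ‖l₁‖ * ‖l₁‖) * C + ‖l‖ * D * C)
    have hC0 : 0 ≤ C := (norm_nonneg _).trans (hC 0).1
    refine ⟨M, fun x => ⟨?_, ?_⟩⟩
    · rw [norm_mul]
      refine mul_le_mul_of_nonneg_left ((norm_add_le _ _).trans ?_) (norm_nonneg _)
      rw [norm_mul, norm_mul, norm_mul]
      have h1 : ‖l ^ 2 * G x - l₁ * conj l₁‖ ≤ ‖l‖ ^ 2 * 1 + ‖l₁‖ * ‖l₁‖ := by
        refine (norm_sub_le _ _).trans (le_of_eq ?_)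
        rw [norm_mul, norm_mul, norm_pow, RCLike.norm_conj, h.norm_G]
      gcongr
      · exact (hC x).1
      · exact hD x
      · exact (hC x).2
    · rw [norm_mul]
      refine mul_le_mul_of_nonneg_left ((norm_add_le _ _).trans ?_) (norm_nonneg _)
      rw [norm_mul, norm_mul, norm_mul, RCLike.norm_conj, add_comm]
      have h1 : ‖l₁ * conj l₁ - l ^ 2 * conj (G x)‖ ≤ ‖l‖ ^ 2 * 1 + ‖l₁‖ * ‖l₁‖ := by
        refine (norm_sub_le _ _).trans (le_of_eq ?_)
        rw [norm_mul, norm_mul, norm_pow, RCLike.norm_conj, RCLike.norm_conj, h.norm_G, add_comm]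
      gcongr
      · exact (hC x).2
      · exact hD x
      · exact (hC x).1
  · have := ((((h.tendsto_G_atBot.const_mul (l ^ 2)).sub_const (l₁ * conj l₁)).mul
      hpq.tendsto_fst).add ((h.tendsto_b_atBot.const_mul l).mul hpq.tendsto_snd)).const_mul c
    convert! this using 2
    rw [hc]
    field_simp
    ring
  · have hb : Tendsto (fun x => conj (b x)) atBot (𝓝 (conj 0)) :=
      (Complex.continuous_conj.tendsto _).comp h.tendsto_b_atBot
    have hG : Tendsto (fun x => conj (G x)) atBot (𝓝 (conj (conj l₁ / l₁))) :=
      (Complex.continuous_conj.tendsto _).comp h.tendsto_G_atBot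
    have := (((hb.const_mul l).mul hpq.tendsto_fst).add
      (((hG.const_mul (l ^ 2)).const_sub (l₁ * conj l₁)).mul hpq.tendsto_snd)).const_mul c
    convert! this using 2
    simp

/-- The effect of the Darboux transformation on the scattering coefficient: the quotient is
`det T` up to normalization. -/
theorem IsDarboux.scatA_eq (h : IsDarboux l₁ u u₁ G b) (h₁ : l₁ ≠ 0) (hu : Continuous u)
    (hi : Integrable u) (hu₁ : Continuous u₁) (hi₁ : Integrable u₁) {l : ℂ}
    (hl : 0 ≤ (l ^ 2).im) (hne : l ^ 2 ≠ l₁ ^ 2) :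
    scatA u₁ l =
      scatA u l * (l₁ ^ 2 / conj l₁ ^ 2) * ((l ^ 2 - conj l₁ ^ 2) / (l ^ 2 - l₁ ^ 2)) := by
  have A := jostMinus_spec hu hi hl
  have B := jostPlus_spec hu hi hl
  rw [scatA_eq_of_isMinusPair hu hi hl A B,
    scatA_eq_of_isMinusPair hu₁ hi₁ hl (h.isMinusPair h₁ hne A) (h.reflect.isMinusPair h₁ hne B)]
  have hc₁ : conj l₁ ≠ 0 := by simpa using h₁
  have hsub : l ^ 2 - l₁ ^ 2 ≠ 0 := sub_ne_zero.2 hne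
  simp only [KN.reflect, neg_zero, map_neg, Complex.conj_conj]
  have det : (l ^ 2 * G 0 - l₁ * conj l₁) * (l ^ 2 * conj (G 0) - l₁ * conj l₁)
      + l ^ 2 * (b 0 * conj (b 0)) = (l ^ 2 - l₁ ^ 2) * (l ^ 2 - conj l₁ ^ 2) := by
    linear_combination l ^ 4 * h.mul_conj 0 - l ^ 2 * h.trace 0
  have e : ∀ c p q P Q : ℂ,
      c * ((l ^ 2 * G 0 - l₁ * conj l₁) * p + l * b 0 * q) *
        (c * ((l ^ 2 * conj (G 0) - l₁ * conj l₁) * P + l * -conj (b 0) * Q)) -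
      c * (l * -b 0 * P + (l₁ * conj l₁ - l ^ 2 * G 0) * Q) *
        (c * (l * conj (b 0) * p + (l₁ * conj l₁ - l ^ 2 * conj (G 0)) * q)) =
      c ^ 2 * ((l ^ 2 - l₁ ^ 2) * (l ^ 2 - conj l₁ ^ 2)) * (p * P - Q * q) := fun c p q P Q => by
    rw [← det]; ring
  rw [e]
  field_simp

end

/-! ### The Darboux transformation generated by a Jost function -/

/-- The off-diagonal coefficient `b` of the Darboux matrix with kernel vector `η`, related to
`S_l(η)` by `S = -2 i b`. -/
noncomputable def opB (l : ℂ) (η : Fin 2 → ℂ) : ℂ :=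
  -(l ^ 2 - conj l ^ 2) * (η 0 * conj (η 1) / dForm l η η)

lemma backlund_eq (l : ℂ) (η : ℝ → Fin 2 → ℂ) (u : ℝ → ℂ) (x : ℝ) :
    backlund l η u x =
      -opG l (η x) ^ 2 * u x - 2 * Complex.I * opG l (η x) * opB l (η x) := by
  simp only [backlund, opS, opB]
  ring

lemma dForm_smul (l c : ℂ) (η : Fin 2 → ℂ) :
    dForm l (c • η) (c • η) = c * conj c * dForm l η η := by
  simp only [dForm, Pi.smul_apply, smul_eq_mul, map_mul]
  ring

lemma opG_smul (l : ℂ) {c : ℂ} (hc : c ≠ 0) (η : Fin 2 → ℂ) : opG l (c • η) = opG l η := by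
  have : c * conj c ≠ 0 := mul_ne_zero hc (by simpa using hc)
  rw [opG, dForm_smul, dForm_smul, mul_div_mul_left _ _ this, opG]

lemma opB_smul (l : ℂ) {c : ℂ} (hc : c ≠ 0) (η : Fin 2 → ℂ) : opB l (c • η) = opB l η := by
  have : c * conj c ≠ 0 := mul_ne_zero hc (by simpa using hc)
  rw [opB, dForm_smul, opB]
  congr 1
  rw [← mul_div_mul_left (η 0 * conj (η 1)) _ this]
  simp only [Pi.smul_apply, smul_eq_mul, map_mul]
  ring

lemma re_dForm (l : ℂ) (η : Fin 2 → ℂ) :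
    (dForm l η η).re = l.re * (‖η 0‖ ^ 2 + ‖η 1‖ ^ 2) := by
  simp only [dForm, mul_assoc, Complex.mul_conj, Complex.add_re, Complex.re_mul_ofReal,
    Complex.conj_re, Complex.normSq_eq_norm_sq]
  ring

lemma dForm_ne_zero {l : ℂ} (hl : 0 < l.re) {η : Fin 2 → ℂ}
    (hη : 0 < ‖η 0‖ ^ 2 + ‖η 1‖ ^ 2) : dForm l η η ≠ 0 := by
  intro h
  have := re_dForm l η
  rw [h, Complex.zero_re] at this
  have h2 := mul_pos hl hη
  linarith

lemma norm_opB_mul_le {l : ℂ} (hl : 0 < l.re) {η : Fin 2 → ℂ}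
    (hη : 0 < ‖η 0‖ ^ 2 + ‖η 1‖ ^ 2) :
    ‖opB l η‖ * (l.re * (‖η 0‖ ^ 2 + ‖η 1‖ ^ 2)) ≤ ‖l ^ 2 - conj l ^ 2‖ * (‖η 0‖ * ‖η 1‖) := by
  have hd := dForm_ne_zero hl hη
  have h1 : l.re * (‖η 0‖ ^ 2 + ‖η 1‖ ^ 2) ≤ ‖dForm l η η‖ := by
    rw [← re_dForm]; exact Complex.re_le_norm _
  calc _ ≤ ‖opB l η‖ * ‖dForm l η η‖ := by gcongr
    _ = ‖opB l η * dForm l η η‖ := (norm_mul _ _).symm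
    _ = ‖-(l ^ 2 - conj l ^ 2) * (η 0 * conj (η 1))‖ := by
        rw [opB, mul_assoc, div_mul_cancel₀ _ hd]
    _ = _ := by rw [norm_mul, norm_mul, norm_neg, RCLike.norm_conj]

lemma norm_opB_le {l : ℂ} (hl : 0 < l.re) {η : Fin 2 → ℂ}
    (hη : 0 < ‖η 0‖ ^ 2 + ‖η 1‖ ^ 2) : ‖opB l η‖ ≤ ‖l ^ 2 - conj l ^ 2‖ / l.re := by
  rw [le_div_iff₀ hl]
  refine le_of_mul_le_mul_right ?_ hη
  calc _ = ‖opB l η‖ * (l.re * (‖η 0‖ ^ 2 + ‖η 1‖ ^ 2)) := by ring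
    _ ≤ _ := norm_opB_mul_le hl hη
    _ ≤ _ := by
      gcongr
      nlinarith [sq_nonneg (‖η 0‖ - ‖η 1‖), sq_nonneg (‖η 0‖), sq_nonneg ‖η 1‖]

/-- Away from the zeros of one component, `b` is controlled by the other component. -/
lemma norm_opB_le_of_half_le {l : ℂ} (hl : 0 < l.re) {η : Fin 2 → ℂ} {r s : ℝ} (hr : 1 / 2 ≤ r)
    (hrs : ‖η 0‖ * ‖η 1‖ = r * s) (hrs2 : ‖η 0‖ ^ 2 + ‖η 1‖ ^ 2 = r ^ 2 + s ^ 2) :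
    ‖opB l η‖ ≤ 2 * ‖l ^ 2 - conj l ^ 2‖ / l.re * s := by
  have hη : 0 < ‖η 0‖ ^ 2 + ‖η 1‖ ^ 2 := by rw [hrs2]; positivity
  have h := norm_opB_mul_le hl hη
  rw [hrs, hrs2] at h
  have h0 := norm_nonneg (opB l η)
  have h2 : ‖opB l η‖ * l.re * r ≤ ‖l ^ 2 - conj l ^ 2‖ * s := by
    have hr0 : 0 < r := by linarith
    refine le_of_mul_le_mul_right ?_ hr0
    have : 0 ≤ ‖opB l η‖ * l.re * s ^ 2 := by positivity
    linarith
  have h3 : ‖opB l η‖ * l.re * (1 / 2) ≤ ‖opB l η‖ * l.re * r := by gcongr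
  rw [div_mul_eq_mul_div, le_div_iff₀ hl]
  linarith

lemma exists_eq_smul_of_mul_eq {p q P Q : ℂ} (h : p * P = Q * q)
    (hpq : 0 < ‖p‖ ^ 2 + ‖q‖ ^ 2) (hPQ : 0 < ‖P‖ ^ 2 + ‖Q‖ ^ 2) :
    ∃ c : ℂ, c ≠ 0 ∧ ![p, q] = c • ![Q, P] := by
  by_cases hP : P = 0
  · have hQ : Q ≠ 0 := by
      rintro rfl
      simp [hP] at hPQ
    have hq : q = 0 := by
      rw [hP, mul_zero] at h
      exact (mul_eq_zero.1 h.symm).resolve_left hQ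
    have hp : p ≠ 0 := by
      rintro rfl
      simp [hq] at hpq
    refine ⟨p / Q, div_ne_zero hp hQ, ?_⟩
    simp [hP, hq, hQ]
  · have hp : p = q / P * Q := by
      field_simp
      linear_combination h
    have hq : q ≠ 0 := by
      rintro rfl
      simp [hp] at hpq
    refine ⟨q / P, div_ne_zero hq hP, ?_⟩
    simp [hP, ← hp]

/-- The derivative of `G`; primes stand for complex conjugates. -/
lemma darboux_deriv_G (i l l' p p' q q' u u' : ℂ) {d e : ℂ}
    (hd : d = l * p * p' + l' * q * q') (he : e = l' * p * p' + l * q * q')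
    (hd0 : d ≠ 0) (he0 : e ≠ 0) :
    ((l' * (l * u * q) * p' + l' * p * (l' * u' * q') +
        (l * (2 * i * l ^ 2 * q - l * u' * p) * q' +
          l * q * (2 * -i * l' ^ 2 * q' - l' * u * p'))) * d -
      e * (l * (l * u * q) * p' + l * p * (l' * u' * q') +
        (l' * (2 * i * l ^ 2 * q - l * u' * p) * q' +
          l' * q * (2 * -i * l' ^ 2 * q' - l' * u * p')))) / d ^ 2 =
      (-(e / d) ^ 2 * u - 2 * i * (e / d) * (-(l ^ 2 - l' ^ 2) * (p * q' / d))) *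
          ((l ^ 2 - l' ^ 2) * (p' * q / e)) +
        -(l ^ 2 - l' ^ 2) * (p * q' / d) * u' := by
  field_simp
  rw [hd, he]
  ring

/-- The derivative of `b`; primes stand for complex conjugates. -/
lemma darboux_deriv_b (i l l' p p' q q' u u' : ℂ) {d e : ℂ}
    (hd : d = l * p * p' + l' * q * q') (he : e = l' * p * p' + l * q * q') (hd0 : d ≠ 0) :
    -(l ^ 2 - l' ^ 2) * (((l * u * q * q' + p * (2 * -i * l' ^ 2 * q' - l' * u * p')) * d -
      p * q' * (l * (l * u * q) * p' + l * p * (l' * u' * q') +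
        (l' * (2 * i * l ^ 2 * q - l * u' * p) * q' +
          l' * q * (2 * -i * l' ^ 2 * q' - l' * u * p')))) / d ^ 2) =
      l * l' * (-(e / d) ^ 2 * u - 2 * i * (e / d) * (-(l ^ 2 - l' ^ 2) * (p * q' / d)) + u) := by
  field_simp
  rw [hd, he]
  ring

section

variable {u : ℝ → ℂ} {l : ℂ} {p q P Q : ℝ → ℂ}

lemma tendsto_opG {F : Filter ℝ} {f g : ℝ → ℂ} {α β : ℂ} (hf : Tendsto f F (𝓝 α))
    (hg : Tendsto g F (𝓝 β)) (hd : dForm l ![α, β] ![α, β] ≠ 0) :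
    Tendsto (fun x => opG l ![f x, g x]) F (𝓝 (opG l ![α, β])) ∧
      Tendsto (fun x => opB l ![f x, g x]) F (𝓝 (opB l ![α, β])) := by
  have hf' : Tendsto (fun x => conj (f x)) F (𝓝 (conj α)) :=
    (Complex.continuous_conj.tendsto _).comp hf
  have hg' : Tendsto (fun x => conj (g x)) F (𝓝 (conj β)) :=
    (Complex.continuous_conj.tendsto _).comp hg
  have hD : ∀ m : ℂ, Tendsto (fun x => dForm m ![f x, g x] ![f x, g x]) F
      (𝓝 (dForm m ![α, β] ![α, β])) := fun m =>
    ((hf.const_mul m).mul hf').add ((hg.const_mul (conj m)).mul hg')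
  exact ⟨(hD _).div (hD _) hd, ((hf.mul hg').div (hD _) hd).const_mul _⟩

/-- At a zero `l` of the scattering coefficient, the Jost function `φ₋` generates a Darboux
transformation. Its coefficients are computed at `+∞` from the Jost function `ϕ₊`, to which `φ₋` is
proportional. -/
theorem isDarboux_of_isMinusPair (hu : Continuous u) (hi : Integrable u) (hre : 0 < l.re)
    (hl : 0 ≤ (l ^ 2).im) (h : IsMinusPair u l p q) (H : IsMinusPair (reflect u) l P Q)
    (ha : scatA u l = 0) :
    IsDarboux l u (backlund l (fun x => ![p x, q x]) u)
      (fun x => opG l ![p x, q x]) (fun x => opB l ![p x, q x]) := by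
  have hpos := h.norm_sq_pos hu hl
  have Hpos := H.norm_sq_pos (continuous_reflect hu) hl
  have hd : ∀ x, l * p x * conj (p x) + conj l * q x * conj (q x) ≠ 0 := fun x => by
    have := dForm_ne_zero hre (η := ![p x, q x]) (by simpa using hpos x)
    simpa [dForm] using this
  have he : ∀ x, conj l * p x * conj (p x) + l * q x * conj (q x) ≠ 0 := fun x => by
    have := dForm_ne_zero (l := conj l) (by simpa using hre) (η := ![p x, q x])
      (by simpa using hpos x)
    simpa [dForm] using this
  have hdc : ∀ x, conj (l * p x * conj (p x) + conj l * q x * conj (q x)) =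
      conj l * p x * conj (p x) + l * q x * conj (q x) := fun x => by
    simp only [map_add, map_mul, Complex.conj_conj]; ring
  have hec : ∀ x, conj (conj l * p x * conj (p x) + l * q x * conj (q x)) =
      l * p x * conj (p x) + conj l * q x * conj (q x) := fun x => by
    simp only [map_add, map_mul, Complex.conj_conj]; ring
  have hG : ∀ x, opG l ![p x, q x] = (conj l * p x * conj (p x) + l * q x * conj (q x)) /
      (l * p x * conj (p x) + conj l * q x * conj (q x)) := fun x => by simp [opG, dForm]
  have hB : ∀ x, opB l ![p x, q x] = -(l ^ 2 - conj l ^ 2) * (p x * conj (q x) /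
      (l * p x * conj (p x) + conj l * q x * conj (q x))) := fun x => by simp [opB, dForm]
  have hGc : ∀ x, conj (opG l ![p x, q x]) =
      (l * p x * conj (p x) + conj l * q x * conj (q x)) /
      (conj l * p x * conj (p x) + l * q x * conj (q x)) := fun x => by
    rw [hG, map_div₀, hdc, hec]
  have hBc : ∀ x, conj (opB l ![p x, q x]) = (l ^ 2 - conj l ^ 2) * (conj (p x) * q x /
      (conj l * p x * conj (p x) + l * q x * conj (q x))) := fun x => by
    rw [hB]
    simp only [map_mul, map_neg, map_sub, map_pow, map_div₀, hdc, Complex.conj_conj]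
    ring
  have hdd : ∀ x, HasDerivAt (fun x => l * p x * conj (p x) + conj l * q x * conj (q x)) _ x :=
    fun x => (((h.deriv_fst x).const_mul l).mul (hasDerivAt_conj (h.deriv_fst x))).add
      (((h.deriv_snd x).const_mul (conj l)).mul (hasDerivAt_conj (h.deriv_snd x)))
  have hed : ∀ x, HasDerivAt (fun x => conj l * p x * conj (p x) + l * q x * conj (q x)) _ x :=
    fun x => (((h.deriv_fst x).const_mul (conj l)).mul (hasDerivAt_conj (h.deriv_fst x))).add
      (((h.deriv_snd x).const_mul l).mul (hasDerivAt_conj (h.deriv_snd x)))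
  have hpqd : ∀ x, HasDerivAt (fun x => p x * conj (q x)) _ x :=
    fun x => (h.deriv_fst x).mul (hasDerivAt_conj (h.deriv_snd x))
  -- At `+∞` the kernel vector is replaced by the proportional vector `ϕ₊`.
  have hprop : ∀ x, ∃ c : ℂ, c ≠ 0 ∧ ![p x, q x] = c • ![Q (-x), P (-x)] := fun x => by
    have hW := scatA_eq_wronskian hu hi hl h H x
    rw [ha] at hW
    exact exists_eq_smul_of_mul_eq (sub_eq_zero.1 hW.symm) (hpos x) (Hpos (-x))
  have hGp : ∀ x, opG l ![Q (-x), P (-x)] = opG l ![p x, q x] := fun x => by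
    obtain ⟨c, hc, e⟩ := hprop x
    rw [e, opG_smul l hc]
  have hBp : ∀ x, opB l ![Q (-x), P (-x)] = opB l ![p x, q x] := fun x => by
    obtain ⟨c, hc, e⟩ := hprop x
    rw [e, opB_smul l hc]
  have hl0 : l ≠ 0 := by rintro rfl; simp at hre
  have hlc : conj l ≠ 0 := by simpa using hl0
  obtain ⟨tb1, tb2⟩ := tendsto_opG (l := l) h.tendsto_fst h.tendsto_snd
    (by simpa [dForm] using hl0)
  obtain ⟨tt1, tt2⟩ := tendsto_opG (l := l)
    (H.tendsto_snd.comp tendsto_neg_atTop_atBot) (H.tendsto_fst.comp tendsto_neg_atTop_atBot)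
    (by simpa [dForm] using hl0)
  simp only [Function.comp_apply, hGp, hBp] at tt1 tt2
  refine ⟨fun x => ?_, fun x => ?_, fun x => backlund_eq _ _ _ _, fun x => ?_, fun x => ?_,
    ⟨_, fun x => norm_opB_le hre (by simpa using hpos x)⟩, ?_, ?_, ?_, ?_⟩
  · simp only [hGc]
    rw [hG, div_mul_div_comm, mul_comm, div_self (mul_ne_zero (hd x) (he x))]
  · simp only [hGc, hBc]
    rw [hG, hB]
    have := hd x
    have := he x
    field_simp
    ring
  · rw [backlund_eq]
    simp only [hBc]
    rw [hG, hB, show (fun x => opG l ![p x, q x]) = _ from funext hG]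
    refine ((hed x).div (hdd x) (hd x)).congr_deriv ?_
    simp only [map_sub, map_mul, map_pow, map_ofNat, Complex.conj_I, Complex.conj_conj]
    exact darboux_deriv_G _ _ _ _ _ _ _ _ _ rfl rfl (hd x) (he x)
  · rw [backlund_eq]
    rw [hG, hB, show (fun x => opB l ![p x, q x]) = _ from funext hB]
    refine (((hpqd x).div (hdd x) (hd x)).const_mul _).congr_deriv ?_
    simp only [map_sub, map_mul, map_pow, map_ofNat, Complex.conj_I, Complex.conj_conj]
    exact darboux_deriv_b _ _ _ _ _ _ _ _ _ rfl rfl (hd x)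
  · simpa [opG, dForm] using tb1
  · simpa [opG, dForm] using tt1
  · simpa [opB] using tb2
  · simpa [opB] using tt2

end

/-! ### Decay of the Darboux coefficient -/

section

variable {u : ℝ → ℂ} {l : ℂ} {p q P Q : ℝ → ℂ}

lemma IsMinusPair.integrableOn_weight_of_le (hu : Continuous u) (hw : MemL21 u)
    (hl : 0 < (l ^ 2).im) (h : IsMinusPair u l p q) {β : ℝ → ℂ} (hβ : Continuous β) {C : ℝ}
    (hle : ∀ x, 1 / 2 ≤ ‖p x‖ → ‖β x‖ ≤ C * ‖q x‖) :
    IntegrableOn (fun x => (1 + x ^ 2) * ‖β x‖ ^ 2) (Set.Iic 0) := by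
  have hev : ∀ᶠ x in atBot, 1 / 2 < ‖p x‖ :=
    h.tendsto_fst.norm.eventually_const_lt (by norm_num)
  obtain ⟨X, hX⟩ := eventually_atBot.1 hev
  have hcont : Continuous fun x : ℝ => (1 + x ^ 2) * ‖β x‖ ^ 2 := by fun_prop
  have hsub : Set.Iic (0 : ℝ) ⊆ Set.Iic (min X 0) ∪ Set.Icc (min X 0) 0 := fun x hx => by
    rcases le_total x (min X 0) with h | h
    · exact Or.inl h
    · exact Or.inr ⟨h, hx⟩
  refine IntegrableOn.mono_set (IntegrableOn.union ?_ hcont.integrableOn_Icc) hsub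
  have hq := ((h.integrableOn_weight hu hw hl).mono_set
    (Set.Iic_subset_Iic.2 (min_le_right X 0))).const_mul (C ^ 2)
  refine Integrable.mono' hq hcont.aestronglyMeasurable ?_
  refine (ae_restrict_iff' measurableSet_Iic).2 (Eventually.of_forall fun x hx => ?_)
  have hb := hle x (hX x (le_trans hx (min_le_left _ _))).le
  rw [Real.norm_of_nonneg (by positivity)]
  calc (1 + x ^ 2) * ‖β x‖ ^ 2 ≤ (1 + x ^ 2) * (C * ‖q x‖) ^ 2 := by gcongr
    _ = _ := by ring

theorem memL21_opB (hu : Continuous u) (hw : MemL21 u) (hre : 0 < l.re) (hl : 0 < (l ^ 2).im)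
    (h : IsMinusPair u l p q) (H : IsMinusPair (reflect u) l P Q) (ha : scatA u l = 0) :
    MemL21 fun x => opB l ![p x, q x] := by
  have hi := hw.integrable
  have hD := isDarboux_of_isMinusPair hu hi hre hl.le h H ha
  have hc : Continuous fun x => opB l ![p x, q x] :=
    continuous_iff_continuousAt.2 fun x => (hD.deriv_b x).continuousAt
  refine memL21_of_integrable_weight hc ?_
  have left := h.integrableOn_weight_of_le hu hw hl hc
    (C := 2 * ‖l ^ 2 - conj l ^ 2‖ / l.re) fun x hx =>
      norm_opB_le_of_half_le hre hx (by simp) (by simp)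
  have right : IntegrableOn
      (fun x => (1 + x ^ 2) * ‖opB l ![p (-x), q (-x)]‖ ^ 2) (Set.Iic 0) := by
    refine H.integrableOn_weight_of_le (continuous_reflect hu) hw.comp_neg hl
      (hc.comp continuous_neg) (C := 2 * ‖l ^ 2 - conj l ^ 2‖ / l.re) fun x hx => ?_
    have hW := scatA_eq_wronskian hu hi hl.le h H (-x)
    rw [ha] at hW
    obtain ⟨c, hc0, e⟩ := exists_eq_smul_of_mul_eq (sub_eq_zero.1 hW.symm)
      (h.norm_sq_pos hu hl.le (-x)) (H.norm_sq_pos (continuous_reflect hu) hl.le (-(-x)))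
    simp only [e, opB_smul l hc0, neg_neg]
    exact norm_opB_le_of_half_le hre hx (by simp [mul_comm]) (by simp [add_comm])
  have right' : IntegrableOn (fun x => (1 + x ^ 2) * ‖opB l ![p x, q x]‖ ^ 2) (Set.Ici 0) := by
    have hr := right
    rw [← neg_zero] at hr
    simpa using hr.comp_neg_Ici
  rw [← integrableOn_univ, ← Set.Iic_union_Ici (a := (0 : ℝ))]
  exact left.union right'

end

/-! ### Regularity of the transformed potential -/

/-- Continuously differentiable functions that are bounded together with their derivative. -/
structure IsBoundedC1 (f : ℝ → ℂ) : Prop where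
  contDiff : ContDiff ℝ 1 f
  bounded : ∃ C : ℝ, ∀ x, ‖f x‖ ≤ C
  bounded' : ∃ C : ℝ, ∀ x, ‖deriv f x‖ ≤ C

/-- Continuously differentiable functions in `L^{2,1}(ℝ) ∩ L^∞(ℝ)` with derivative in
`L²(ℝ) ∩ L^∞(ℝ)`. They form an ideal in the bounded `C¹` functions. -/
structure IsDecaying (f : ℝ → ℂ) : Prop extends IsBoundedC1 f where
  memL21 : MemL21 f
  memLp_deriv : MemLp (deriv f) 2 volume

lemma memLp_bounded_mul {f g : ℝ → ℂ} (hf : Continuous f) (hb : ∃ C : ℝ, ∀ x, ‖f x‖ ≤ C)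
    (hg : MemLp g 2 volume) : MemLp (fun x => f x * g x) 2 volume := by
  obtain ⟨C, hC⟩ := hb
  refine MemLp.of_le_mul (c := C) hg (hf.aestronglyMeasurable.mul hg.1)
    (Eventually.of_forall fun x => ?_)
  rw [norm_mul]
  gcongr
  exact hC x

section

variable {f g : ℝ → ℂ}

lemma isBoundedC1_of_hasDerivAt {f' : ℝ → ℂ} (hf : ∀ x, HasDerivAt f (f' x) x)
    (hc : Continuous f') (hb : ∃ C : ℝ, ∀ x, ‖f x‖ ≤ C) (hb' : ∃ C : ℝ, ∀ x, ‖f' x‖ ≤ C) :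
    IsBoundedC1 f := by
  have e : deriv f = f' := funext fun x => (hf x).deriv
  exact ⟨contDiff_one_iff_deriv.2 ⟨fun x => (hf x).differentiableAt, by rwa [e]⟩, hb, by rwa [e]⟩

lemma IsBoundedC1.hasDerivAt (hf : IsBoundedC1 f) (x : ℝ) : HasDerivAt f (deriv f x) x :=
  (hf.contDiff.differentiable one_ne_zero x).hasDerivAt

lemma IsBoundedC1.continuous_deriv (hf : IsBoundedC1 f) : Continuous (deriv f) :=
  hf.contDiff.continuous_deriv le_rfl

lemma isBoundedC1_const (c : ℂ) : IsBoundedC1 fun _ => c :=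
  ⟨contDiff_const, ⟨‖c‖, fun _ => le_rfl⟩, ⟨0, fun x => by simp⟩⟩

lemma exists_bound_mul (hf : ∃ C : ℝ, ∀ x, ‖f x‖ ≤ C) (hg : ∃ C : ℝ, ∀ x, ‖g x‖ ≤ C) :
    ∃ C : ℝ, ∀ x, ‖f x * g x‖ ≤ C := by
  obtain ⟨C, hC⟩ := hf
  obtain ⟨D, hD⟩ := hg
  refine ⟨C * D, fun x => ?_⟩
  rw [norm_mul]
  exact mul_le_mul (hC x) (hD x) (norm_nonneg _) ((norm_nonneg _).trans (hC x))

lemma exists_bound_add (hf : ∃ C : ℝ, ∀ x, ‖f x‖ ≤ C) (hg : ∃ C : ℝ, ∀ x, ‖g x‖ ≤ C) :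
    ∃ C : ℝ, ∀ x, ‖f x + g x‖ ≤ C := by
  obtain ⟨C, hC⟩ := hf
  obtain ⟨D, hD⟩ := hg
  exact ⟨C + D, fun x => (norm_add_le _ _).trans (add_le_add (hC x) (hD x))⟩

lemma exists_bound_conj (hf : ∃ C : ℝ, ∀ x, ‖f x‖ ≤ C) : ∃ C : ℝ, ∀ x, ‖conj (f x)‖ ≤ C := by
  simpa using hf

lemma IsBoundedC1.mul (hf : IsBoundedC1 f) (hg : IsBoundedC1 g) :
    IsBoundedC1 fun x => f x * g x :=
  isBoundedC1_of_hasDerivAt (fun x => (hf.hasDerivAt x).mul (hg.hasDerivAt x))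
    ((hf.continuous_deriv.mul hg.contDiff.continuous).add
      (hf.contDiff.continuous.mul hg.continuous_deriv))
    (exists_bound_mul hf.bounded hg.bounded)
    (exists_bound_add (exists_bound_mul hf.bounded' hg.bounded)
      (exists_bound_mul hf.bounded hg.bounded'))

lemma IsBoundedC1.add (hf : IsBoundedC1 f) (hg : IsBoundedC1 g) :
    IsBoundedC1 fun x => f x + g x :=
  isBoundedC1_of_hasDerivAt (fun x => (hf.hasDerivAt x).add (hg.hasDerivAt x))
    (hf.continuous_deriv.add hg.continuous_deriv) (exists_bound_add hf.bounded hg.bounded)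
    (exists_bound_add hf.bounded' hg.bounded')

lemma memL21_bounded_mul (hf : Continuous f) (hb : ∃ C : ℝ, ∀ x, ‖f x‖ ≤ C)
    (hg : Continuous g) (hw : MemL21 g) : MemL21 fun x => f x * g x := by
  obtain ⟨C, hC⟩ := hb
  refine hw.of_le (hf.mul hg) C fun x => ?_
  rw [norm_mul]
  gcongr
  exact hC x

lemma IsBoundedC1.mul_isDecaying (hf : IsBoundedC1 f) (hg : IsDecaying g) :
    IsDecaying fun x => f x * g x := by
  refine ⟨hf.mul hg.toIsBoundedC1,
    memL21_bounded_mul hf.contDiff.continuous hf.bounded hg.contDiff.continuous hg.memL21, ?_⟩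
  have e : deriv (fun x => f x * g x) = fun x => deriv f x * g x + f x * deriv g x :=
    funext fun x => ((hf.hasDerivAt x).mul (hg.hasDerivAt x)).deriv
  rw [e]
  exact (memLp_bounded_mul hf.continuous_deriv hf.bounded' hg.memL21.memLp).add
    (memLp_bounded_mul hf.contDiff.continuous hf.bounded hg.memLp_deriv)

lemma IsDecaying.add (hf : IsDecaying f) (hg : IsDecaying g) :
    IsDecaying fun x => f x + g x := by
  refine ⟨hf.toIsBoundedC1.add hg.toIsBoundedC1, hf.memL21.add hg.memL21, ?_⟩
  have e : deriv (fun x => f x + g x) = fun x => deriv f x + deriv g x :=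
    funext fun x => ((hf.hasDerivAt x).add (hg.hasDerivAt x)).deriv
  rw [e]
  exact hf.memLp_deriv.add hg.memLp_deriv

lemma IsBoundedC1.conj (hf : IsBoundedC1 f) : IsBoundedC1 fun x => conj (f x) :=
  isBoundedC1_of_hasDerivAt (fun x => hasDerivAt_conj (hf.hasDerivAt x))
    (Complex.continuous_conj.comp hf.continuous_deriv) (exists_bound_conj hf.bounded)
    (exists_bound_conj hf.bounded')

end

/-- The transformed potential has the regularity of the original one. In `u₁' = -G² u' + r` the
remainder `r` is a polynomial in `G, b, u` and their conjugates each of whose terms contains `b` or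
`u`, so that it can be differentiated once more. -/
theorem IsDarboux.memH2_memH11 {l₁ : ℂ} {U V w u₁ G b : ℝ → ℂ} (hU : IsRegular U V w)
    (h : IsDarboux l₁ U u₁ G b) (hb : MemL21 b) :
    Continuous u₁ ∧ MemL21 u₁ ∧ MemH2 u₁ ∧ MemH11 u₁ := by
  set N := l₁ * conj l₁ with hN
  have hUc := hU.continuous
  have hVc := hU.isPrimitive.continuous
  have hGc : Continuous G := continuous_iff_continuousAt.2 fun x => (h.deriv_G x).continuousAt
  have hbc : Continuous b := continuous_iff_continuousAt.2 fun x => (h.deriv_b x).continuousAt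
  have hGb : ∃ C : ℝ, ∀ x, ‖G x‖ ≤ C := ⟨1, fun x => (h.norm_G x).le⟩
  have e₁ : u₁ = fun x => -G x ^ 2 * U x + (-2 * Complex.I * G x) * b x := by
    funext x; rw [h.eq]; ring
  have hG2b : ∃ C : ℝ, ∀ x, ‖-G x ^ 2‖ ≤ C := ⟨1, fun x => by simp [h.norm_G]⟩
  have hGIb : ∃ C : ℝ, ∀ x, ‖-2 * Complex.I * G x‖ ≤ C := ⟨2, fun x => by simp [h.norm_G]⟩
  have hu₁c : Continuous u₁ := by rw [e₁]; fun_prop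
  have hu₁b : ∃ C : ℝ, ∀ x, ‖u₁ x‖ ≤ C := by
    rw [e₁]
    exact exists_bound_add (exists_bound_mul hG2b hU.bounded) (exists_bound_mul hGIb h.bounded)
  have hu₁w : MemL21 u₁ := by
    rw [e₁]
    exact (memL21_bounded_mul (by fun_prop) hG2b hUc hU.memL21).add
      (memL21_bounded_mul (by fun_prop) hGIb hbc hb)
  have dU : IsDecaying U := by
    refine ⟨isBoundedC1_of_hasDerivAt hU.hasDerivAt hVc hU.bounded hU.bounded', hU.memL21, ?_⟩
    rw [show deriv U = V from funext fun x => (hU.hasDerivAt x).deriv]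
    exact hU.memL21'.memLp
  have cN : ∃ C : ℝ, ∀ _ : ℝ, ‖N‖ ≤ C := ⟨‖N‖, fun _ => le_rfl⟩
  have db : IsDecaying b := by
    refine ⟨isBoundedC1_of_hasDerivAt h.deriv_b (by fun_prop) h.bounded
      (exists_bound_mul cN (exists_bound_add hu₁b hU.bounded)), hb, ?_⟩
    rw [show deriv b = fun x => N * (u₁ x + U x) from funext fun x => (h.deriv_b x).deriv]
    exact memLp_bounded_mul continuous_const cN (hu₁w.add hU.memL21).memLp
  have bG : IsBoundedC1 G := by
    have c1 : Continuous fun x => conj (b x) := Complex.continuous_conj.comp hbc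
    have c2 : Continuous fun x => conj (U x) := Complex.continuous_conj.comp hUc
    exact isBoundedC1_of_hasDerivAt h.deriv_G (by fun_prop) hGb
      (exists_bound_add (exists_bound_mul hu₁b (exists_bound_conj h.bounded))
        (exists_bound_mul h.bounded (exists_bound_conj hU.bounded)))
  have bG2 : IsBoundedC1 fun x => -G x ^ 2 := by
    have := (isBoundedC1_const (-1)).mul (bG.mul bG)
    convert! this using 2
    ring
  have bGI : IsBoundedC1 fun x => -2 * Complex.I * G x := (isBoundedC1_const _).mul bG
  have du₁ : IsDecaying u₁ := by
    rw [e₁]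
    exact (bG2.mul_isDecaying dU).add (bGI.mul_isDecaying db)
  set G' : ℝ → ℂ := fun x => u₁ x * conj (b x) + b x * conj (U x) with hG'
  have bG' : IsBoundedC1 G' :=
    (du₁.mul db.conj).add (db.mul dU.conj)
  set r : ℝ → ℂ := fun x => ((-2 * G x) * G' x) * U x +
    ((-2 * Complex.I * G' x) * b x + (-2 * Complex.I * G x * N) * (u₁ x + U x)) with hr
  have dr : IsDecaying r :=
    ((((isBoundedC1_const _).mul bG).mul bG').mul_isDecaying dU).add
      ((((isBoundedC1_const _).mul bG').mul_isDecaying db).add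
        ((bGI.mul (isBoundedC1_const N)).mul_isDecaying (du₁.add dU)))
  have hd : ∀ x, HasDerivAt u₁ (-G x ^ 2 * V x + r x) x := fun x => by
    rw [e₁]
    refine ((((h.deriv_G x).pow 2).neg.mul (hU.hasDerivAt x)).add
      (((h.deriv_G x).const_mul (-2 * Complex.I)).mul (h.deriv_b x))).congr_deriv ?_
    simp only [hr, hG', Pi.neg_apply, Pi.pow_apply]
    ring
  have hvc : Continuous fun x => -G x ^ 2 * V x + r x :=
    (bG2.contDiff.continuous.mul hVc).add dr.contDiff.continuous
  have p₁ := isPrimitive_of_hasDerivAt hd hvc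
  have p₂ := (hU.isPrimitive.smul_of_contDiff bG2.hasDerivAt bG2.continuous_deriv).add
    (isPrimitive_of_hasDerivAt dr.hasDerivAt dr.continuous_deriv)
  have hv : MemL21 fun x => -G x ^ 2 * V x + r x :=
    (memL21_bounded_mul bG2.contDiff.continuous hG2b hVc hU.memL21').add dr.memL21
  refine ⟨hu₁c, hu₁w, ⟨_, _, p₁.hasWeakDeriv, p₂.hasWeakDeriv, hu₁w.memLp, hv.memLp, ?_⟩,
    ⟨_, p₁.hasWeakDeriv, hu₁w, hv⟩⟩
  exact ((memLp_bounded_mul bG2.continuous_deriv bG2.bounded' hU.memL21'.memLp).add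
    (memLp_bounded_mul bG2.contDiff.continuous hG2b hU.memLp)).add dr.memLp_deriv

/-! ### The first quadrant and the zero of the scattering coefficient -/

lemma im_sq_pos {l : ℂ} (hl : l ∈ firstQuadrant) : 0 < (l ^ 2).im := by
  have := mul_pos hl.1 hl.2
  rw [pow_two, Complex.mul_im]
  linarith

lemma sq_ne_sq_of_mem_firstQuadrant {l l₁ : ℂ} (hl : l ∈ firstQuadrant)
    (hl₁ : l₁ ∈ firstQuadrant) (hne : l ≠ l₁) : l ^ 2 ≠ l₁ ^ 2 := by
  intro h
  rcases sq_eq_sq_iff_eq_or_eq_neg.1 h with h | h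
  · exact hne h
  · have := hl.1
    rw [h, Complex.neg_re] at this
    linarith [hl₁.1]

lemma sq_sub_conj_sq_ne_zero {l l₁ : ℂ} (hl : 0 ≤ (l ^ 2).im) (hl₁ : 0 < (l₁ ^ 2).im) :
    l ^ 2 - conj l₁ ^ 2 ≠ 0 := by
  intro h
  have e := congrArg Complex.im (sub_eq_zero.1 h)
  rw [← map_pow, Complex.conj_im] at e
  linarith

lemma eventually_sq_ne {μ l₁ : ℂ} (hμ : μ ^ 2 = l₁ ^ 2) (hl₁ : 0 < (l₁ ^ 2).im) :
    ∀ᶠ l in 𝓝[≠] μ, 0 ≤ (l ^ 2).im ∧ l ^ 2 ≠ l₁ ^ 2 := by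
  have hμ0 : μ ≠ -μ := by
    intro h
    have : μ = 0 := self_eq_neg.1 h
    rw [← hμ, this] at hl₁
    simp at hl₁
  have hc : Continuous fun l : ℂ => (l ^ 2).im := Complex.continuous_im.comp (by fun_prop)
  have n1 : ∀ᶠ l in 𝓝 μ, 0 < (l ^ 2).im :=
    hc.continuousAt.eventually_const_lt (by simpa only [hμ] using hl₁)
  have n2 : ∀ᶠ l in 𝓝 μ, l ≠ -μ := isOpen_ne.mem_nhds hμ0
  filter_upwards [nhdsWithin_le_nhds n1, nhdsWithin_le_nhds n2, self_mem_nhdsWithin]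
    with l h1 h2 h3
  refine ⟨h1.le, fun h => ?_⟩
  rw [← hμ] at h
  rcases sq_eq_sq_iff_eq_or_eq_neg.1 h with h | h
  · exact h3 h
  · exact h2 h

/-- A simple zero of `a` at `l₁` is cancelled by the pole of the Blaschke-type factor. -/
lemma tendsto_cancel_zero {a : ℂ → ℂ} {l₁ : ℂ} (h0 : l₁ ≠ 0) (ha : a l₁ = 0)
    (hd : DifferentiableAt ℂ a l₁) (c : ℂ) :
    Tendsto (fun l => a l * c * ((l ^ 2 - conj l₁ ^ 2) / (l ^ 2 - l₁ ^ 2))) (𝓝[≠] l₁)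
      (𝓝 (deriv a l₁ * c * ((l₁ ^ 2 - conj l₁ ^ 2) / (l₁ + l₁)))) := by
  have h1 := hasDerivAt_iff_tendsto_slope.1 hd.hasDerivAt
  have h2 : ContinuousAt (fun l : ℂ => (l ^ 2 - conj l₁ ^ 2) / (l + l₁)) l₁ :=
    ContinuousAt.div (by fun_prop) (by fun_prop) (by simpa [← two_mul] using h0)
  refine ((h1.mul_const c).mul (h2.tendsto.mono_left nhdsWithin_le_nhds)).congr' ?_
  filter_upwards [self_mem_nhdsWithin] with l hl
  have : l - l₁ ≠ 0 := sub_ne_zero.2 hl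
  rw [slope_def_field, ha, sub_zero, sq_sub_sq l l₁, div_mul_eq_mul_div, div_mul_div_comm,
    mul_div_assoc', mul_comm (l - l₁)]

end KN

theorem mainTheorem3 (u : ℝ → ℂ) (hu : KN.MemZ 1 u) (l₁ : ℂ) (hl₁ : l₁ ∈ KN.firstQuadrant)
    (ha : KN.scatA u l₁ = 0) (u₁ : ℝ → ℂ)
    (hu₁ : u₁ = KN.backlund l₁ (KN.minusSolution u l₁) u) :
    KN.MemZ 0 u₁ ∧
    (∀ l : ℂ, 0 ≤ (l ^ 2).im → l ^ 2 ≠ l₁ ^ 2 →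
      KN.scatA u₁ l =
        KN.scatA u l * (l₁ ^ 2 / conj l₁ ^ 2) * ((l ^ 2 - conj l₁ ^ 2) / (l ^ 2 - l₁ ^ 2))) ∧
    (∀ μ : ℂ, μ ^ 2 = l₁ ^ 2 →
      Filter.Tendsto
        (fun l : ℂ =>
          KN.scatA u l * (l₁ ^ 2 / conj l₁ ^ 2) * ((l ^ 2 - conj l₁ ^ 2) / (l ^ 2 - l₁ ^ 2)))
        (nhdsWithin μ {μ}ᶜ) (nhds (KN.scatA u₁ μ))) ∧
    (∀ l ∈ KN.firstQuadrant, KN.scatA u₁ l ≠ 0) := by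
  obtain ⟨hH2, hH11, hcard, hsimple⟩ := hu
  obtain ⟨U, V, w, huU, hU⟩ := KN.exists_isRegular hH2 hH11
  have hUc := hU.continuous
  have hUw := hU.memL21
  have hUi := hUw.integrable
  have hpos := KN.im_sq_pos hl₁
  have h0 : l₁ ≠ 0 := by rintro rfl; simp at hpos
  have hc0 : conj l₁ ≠ 0 := by simpa using h0
  have haU : KN.scatA U l₁ = 0 := by rw [← KN.scatA_congr_ae huU]; exact ha
  have A := KN.jostMinus_spec hUc hUi hpos.le
  have B := KN.jostPlus_spec hUc hUi hpos.le
  have hD := KN.isDarboux_of_isMinusPair hUc hUi hl₁.1 hpos.le A B haU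
  have hb := KN.memL21_opB hUc hUw hl₁.1 hpos A B haU
  set U₁ := KN.backlund l₁ (fun x => ![KN.jostMinus U l₁ x 0, KN.jostMinus U l₁ x 1]) U with hU₁
  obtain ⟨hU₁c, hU₁w, hU₁H2, hU₁H11⟩ := hD.memH2_memH11 hU hb
  -- The scalar factor `e^{-i l₁² x}` of the kernel vector drops out.
  have e₁ : u₁ =ᵐ[MeasureTheory.volume] U₁ := by
    filter_upwards [huU] with x hx
    have e : KN.minusSolution u l₁ x = Complex.exp (-Complex.I * l₁ ^ 2 * x) •
        ![KN.jostMinus U l₁ x 0, KN.jostMinus U l₁ x 1] := by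
      rw [KN.minusSolution_congr_ae huU, KN.minusSolution]
      congr 1
      funext i
      fin_cases i <;> rfl
    rw [hu₁, hU₁, KN.backlund_eq, KN.backlund_eq, e, KN.opG_smul _ (Complex.exp_ne_zero _),
      KN.opB_smul _ (Complex.exp_ne_zero _), hx]
  have formula : ∀ l : ℂ, 0 ≤ (l ^ 2).im → l ^ 2 ≠ l₁ ^ 2 → KN.scatA u₁ l =
      KN.scatA u l * (l₁ ^ 2 / conj l₁ ^ 2) * ((l ^ 2 - conj l₁ ^ 2) / (l ^ 2 - l₁ ^ 2)) := by
    intro l hl hne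
    rw [KN.scatA_congr_ae e₁, KN.scatA_congr_ae huU]
    exact hD.scatA_eq h0 hUc hUi hU₁c hU₁w.integrable hl hne
  have limit : ∀ μ : ℂ, μ ^ 2 = l₁ ^ 2 → Filter.Tendsto
      (fun l : ℂ =>
        KN.scatA u l * (l₁ ^ 2 / conj l₁ ^ 2) * ((l ^ 2 - conj l₁ ^ 2) / (l ^ 2 - l₁ ^ 2)))
      (nhdsWithin μ {μ}ᶜ) (nhds (KN.scatA u₁ μ)) := by
    intro μ hμ
    have hcont : ContinuousAt (KN.scatA u₁) μ := by
      rw [KN.scatA_congr_ae e₁]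
      exact KN.continuousAt_scatA hU₁c hU₁w (by rw [hμ]; exact hpos)
    refine (hcont.tendsto.mono_left nhdsWithin_le_nhds).congr' ?_
    filter_upwards [KN.eventually_sq_ne hμ hpos] with l hl
    exact formula l hl.1 hl.2
  have nonzero : ∀ l ∈ KN.firstQuadrant, KN.scatA u₁ l ≠ 0 := by
    have hfac : l₁ ^ 2 / conj l₁ ^ 2 ≠ 0 := div_ne_zero (pow_ne_zero 2 h0) (pow_ne_zero 2 hc0)
    intro l hl
    by_cases hll : l = l₁
    · rw [hll]
      have hder := hsimple l₁ hl₁ ha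
      have := KN.tendsto_cancel_zero h0 ha (differentiableAt_of_deriv_ne_zero hder)
        (l₁ ^ 2 / conj l₁ ^ 2)
      rw [tendsto_nhds_unique (limit l₁ rfl) this]
      refine mul_ne_zero (mul_ne_zero hder hfac)
        (div_ne_zero (KN.sq_sub_conj_sq_ne_zero hpos.le hpos) ?_)
      simpa [← two_mul] using h0
    · have hne := KN.sq_ne_sq_of_mem_firstQuadrant hl hl₁ hll
      have hlpos := KN.im_sq_pos hl
      rw [formula l hlpos.le hne]
      refine mul_ne_zero (mul_ne_zero (fun hz => hll ?_) hfac)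
        (div_ne_zero (KN.sq_sub_conj_sq_ne_zero hlpos.le hpos) (sub_ne_zero.2 hne))
      obtain ⟨z, hz1⟩ := Set.encard_eq_one.1 (by simpa using hcard)
      have m1 : l ∈ {l ∈ KN.firstQuadrant | KN.scatA u l = 0} := ⟨hl, hz⟩
      have m2 : l₁ ∈ {l ∈ KN.firstQuadrant | KN.scatA u l = 0} := ⟨hl₁, ha⟩
      rw [hz1, Set.mem_singleton_iff] at m1 m2
      rw [m1, m2]
  refine ⟨⟨hU₁H2.congr_ae e₁.symm, hU₁H11.congr_ae e₁.symm, ?_,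
    fun l hl hz => absurd hz (nonzero l hl)⟩, formula, limit, nonzero⟩
  rw [Nat.cast_zero, Set.encard_eq_zero]
  exact Set.eq_empty_of_forall_notMem fun l hl => nonzero l hl.1 hl.2
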